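/- Let $\mathcal S$ be a finite family of linear systems $(C,A,B)$ with $A\in\mathbb R^{d_x\times d_x}$, $B\in\mathbb R^{d_x\times d_u}$, $C\in\mathbb R^{d_y\times d_x}$. Call $(C,A,B)$ \emph{stable} if the spectral radius satisfies $\rho(A)<1$ and \emph{unstable} otherwise. For $\varepsilon>0$, call it \emph{strictly observable with margin $\varepsilon$} if $\|Cq\|\ge\varepsilon\|q\|$ for every complex eigenvector $q$ of $A$. For a stable system let $P$ denote the unique solution of the Lyapunov equation $A^\top PA-P+C^\top C=0$. Fix a member $(C',A',B')\in\mathcal S$ and consider $$x_{t+1}=A'x_t+B'u_t+w_t,\qquad y_t=C'x_t+\eta_t,\qquad t\ge 1,$$ where $u_t\sim\mathcal N(0,\sigma_u^2I)$, $w_t\sim\mathcal N(0,\sigma_w^2I)$, $\eta_t\sim\mathcal N(0,\sigma_\eta^2I)$ with $\sigma_w>0$ and $\sigma_u,\sigma_\eta\ge 0$, and where the initial state $x_1$ (of arbitrary law, e.g. $\mathcal N(0,I)$ or deterministic) and all the $u_t,w_t,\eta_t$ are mutually independent. For $M\ge 0$, $\delta\in(0,1/e)$ and an integer $\tau\ge1$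 define $$\xi(M,\tau,\delta)=\max_{(C,A,B)\in\mathcal S\ \text{stable}}\Big\{2M+10\,\tau\big(\sigma_w^2\operatorname{tr}(P)+\sigma_u^2\operatorname{tr}(B^\top PB)+\sigma_\eta^2\max(d_x,d_y)\big)\log(1/\delta)\Big\}$$ (read as $0$ if $\mathcal S$ has no stable member). Then the following hold. 1. Suppose $A'$ is stable. Let $G$ be the event that $x_1^\top Px_1\le M$ for the Lyapunov solution $P$ of every stable member of $\mathcal S$. Then, conditionally on $G$, with probability at least $1-\delta$ we have $\sum_{t=1}^{\tau}\|y_t\|^2\le\xi(M,\tau,\delta)$ for all $\tau\ge1$ simultaneously; that is, $\Pr\big(G\cap\{\forall\tau\ge 1:\ \sum_{t=1}^{\tau}\|y_t\|^2\le\xi(M,\tau,\delta)\}\big)\ge(1-\delta)\Pr(G)$. 2. Let $\varepsilon_a,\varepsilon_c>0$ and $p,b\in\mathbb R$. Suppose $A'$ is unstable with $\rho(A')\ge1+\varepsilon_a$, $(C',A')$ is strictly observable with margin $\varepsilon_c$, and $\|P\|\le p$ and $\|B\|\le b$ (operator norms) for every stable member of $\mathcal S$. Then there is a (deterministic) integer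 $\tau\ge1$ with $$\tau\le K\,\log(2+d_x+d_u+d_y)\,\log\!\Big(\frac{\log(1/\delta)+M}{\delta}\Big)$$ such that $\sum_{t=1}^{\tau}\|y_t\|^2\ge2\,\xi(M,\tau,\delta)$ with probability at least $1-\delta$. Here $K>0$ depends only on $\varepsilon_a,\varepsilon_c,\sigma_w,\sigma_u,\sigma_\eta,p,b$, and not on the dimensions, the family $\mathcal S$ or its size, the law of $x_1$, $M$ or $\delta$. -/

import Mathlib

open MeasureTheory ProbabilityTheory
open scoped Matrix Matrix.Norms.L2Operator

/-- The parameters `(C, A, B)` of a partially observed linear system with state dimension `dx`,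
input dimension `du` and output dimension `dy`. -/
structure LinSys (dx du dy : ℕ) where
  C : Matrix (Fin dy) (Fin dx) ℝ
  A : Matrix (Fin dx) (Fin dx) ℝ
  B : Matrix (Fin dx) (Fin du) ℝ

namespace LinSys

variable {dx du dy : ℕ}

/-- The spectral radius of the state matrix `A`, taken over its complex eigenvalues. -/
noncomputable def specRad (s : LinSys dx du dy) : ENNReal :=
  spectralRadius ℂ (s.A.map (fun r : ℝ => (r : ℂ)))

/-- Stability of the state matrix: spectral radius less than one. -/
def Stable (s : LinSys dx du dy) : Prop := s.specRad < 1

/-- Strict observability with margin `ε`: every complex eigenvector `q` of `A` satisfies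
`‖C q‖ ≥ ε ‖q‖` (Euclidean norms). -/
def StrictlyObservable (s : LinSys dx du dy) (ε : ℝ) : Prop :=
  ∀ (z : ℂ) (q : EuclideanSpace ℂ (Fin dx)), q ≠ 0 →
    Matrix.toEuclideanLin (s.A.map (fun r : ℝ => (r : ℂ))) q = z • q →
      ε * ‖q‖ ≤ ‖Matrix.toEuclideanLin (s.C.map (fun r : ℝ => (r : ℂ))) q‖

/-- `P` solves the discrete Lyapunov equation of `(C, A)`. For a stable `A` there is exactly one
such `P`. -/
def IsLyapunovSolution (s : LinSys dx du dy) (P : Matrix (Fin dx) (Fin dx) ℝ) : Prop :=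
  s.Aᵀ * P * s.A - P + s.Cᵀ * s.C = 0

variable {Ω : Type*}

/-- The states. Times are counted from one, and index `t` here is time `t + 1`, so `state 0` is the initial
state `x₁`. -/
noncomputable def state (s : LinSys dx du dy) (x₁ : Ω → EuclideanSpace ℝ (Fin dx))
    (w : ℕ → Ω → EuclideanSpace ℝ (Fin dx)) (u : ℕ → Ω → EuclideanSpace ℝ (Fin du)) :
    ℕ → Ω → EuclideanSpace ℝ (Fin dx)
  | 0, ω => x₁ ω
  | t + 1, ω => Matrix.toEuclideanLin s.A (s.state x₁ w u t ω)
      + Matrix.toEuclideanLin s.B (u t ω) + w t ω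

/-- The outputs `y = C x + η`, with the same indexing as `state`. -/
noncomputable def output (s : LinSys dx du dy) (x₁ : Ω → EuclideanSpace ℝ (Fin dx))
    (w : ℕ → Ω → EuclideanSpace ℝ (Fin dx)) (u : ℕ → Ω → EuclideanSpace ℝ (Fin du))
    (η : ℕ → Ω → EuclideanSpace ℝ (Fin dy)) (t : ℕ) (ω : Ω) : EuclideanSpace ℝ (Fin dy) :=
  Matrix.toEuclideanLin s.C (s.state x₁ w u t ω) + η t ω

/-- The cumulative squared output norm over the first `τ` time steps. -/
noncomputable def outputEnergy (s : LinSys dx du dy) (x₁ : Ω → EuclideanSpace ℝ (Fin dx))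
    (w : ℕ → Ω → EuclideanSpace ℝ (Fin dx)) (u : ℕ → Ω → EuclideanSpace ℝ (Fin du))
    (η : ℕ → Ω → EuclideanSpace ℝ (Fin dy)) (τ : ℕ) (ω : Ω) : ℝ :=
  ∑ t ∈ Finset.range τ, ‖s.output x₁ w u η t ω‖ ^ 2

end LinSys

/-- The stochastic assumptions: `w t ~ N(0, σw² I)`, `u t ~ N(0, σu² I)`, `η t ~ N(0, ση² I)`,
and `x₁, w 0, w 1, …, u 0, u 1, …, η 0, η 1, …` are mutually independent. The law of the initial
state `x₁` is arbitrary. -/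
structure IsNoiseModel {Ω : Type*} [MeasurableSpace Ω] (μ : Measure Ω) {dx du dy : ℕ}
    (σw σu ση : ℝ) (x₁ : Ω → EuclideanSpace ℝ (Fin dx))
    (w : ℕ → Ω → EuclideanSpace ℝ (Fin dx)) (u : ℕ → Ω → EuclideanSpace ℝ (Fin du))
    (η : ℕ → Ω → EuclideanSpace ℝ (Fin dy)) : Prop where
  measurable_x₁ : Measurable x₁
  measurable_w : ∀ t, Measurable (w t)
  measurable_u : ∀ t, Measurable (u t)
  measurable_η : ∀ t, Measurable (η t)
  law_w : ∀ t, HasLaw (w t) (multivariateGaussian 0 (σw ^ 2 • 1)) μ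
  law_u : ∀ t, HasLaw (u t) (multivariateGaussian 0 (σu ^ 2 • 1)) μ
  law_η : ∀ t, HasLaw (η t) (multivariateGaussian 0 (ση ^ 2 • 1)) μ
  indep : iIndep (Sum.elim (fun _ : Unit => MeasurableSpace.comap x₁ inferInstance)
    (Sum.elim (fun t : ℕ => MeasurableSpace.comap (w t) inferInstance)
      (Sum.elim (fun t : ℕ => MeasurableSpace.comap (u t) inferInstance)
        (fun t : ℕ => MeasurableSpace.comap (η t) inferInstance)))) μ

/-- The threshold `ξ(M, τ, δ)`: the maximum over the stable systems `(C, A, B)` of the family `S`,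
with `P` the solution of the Lyapunov equation of `(C, A)`. The set below is finite when `S` is,
since `P` is unique; if `S` has no stable member, the maximum is read as `0`. -/
noncomputable def threshold {dx du dy : ℕ} (S : Set (LinSys dx du dy)) (σw σu ση : ℝ)
    (M : ℝ) (τ : ℕ) (δ : ℝ) : ℝ :=
  sSup {r : ℝ | ∃ s ∈ S, s.Stable ∧ ∃ P, s.IsLyapunovSolution P ∧
    r = 2 * M + 10 * (τ : ℝ) * (σw ^ 2 * P.trace + σu ^ 2 * (s.Bᵀ * P * s.B).trace
      + ση ^ 2 * (max dx dy : ℕ)) * Real.log (1 / δ)}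

/-- `M` bounds the transient from the initial state `v`: `M ≥ vᵀ P v` for the Lyapunov solution
`P` of every stable system in `S`. -/
def TransientBound {dx du dy : ℕ} (S : Set (LinSys dx du dy)) (M : ℝ)
    (v : EuclideanSpace ℝ (Fin dx)) : Prop :=
  ∀ s ∈ S, s.Stable → ∀ P, s.IsLyapunovSolution P →
    inner ℝ v (Matrix.toEuclideanLin P v) ≤ M

/-! ### Stable systems: the Lyapunov solution as the sum of the Gramian series -/

open Filter Topology

/-! Stable case. The output is the transient `C Aᵗ x₁` plus the output started from zero, so the
energy is at most twice the sum of the two energies. As `P` is the sum of the matrices `(C Aʲ)ᵀ (C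
Aʲ)`, the transient energy is at most `x₁ᵀ P x₁ ≤ M`, and the coordinate variances of each
zero-start output sum to at most the bracket `m` of the threshold. What remains is that, with `L =
log (1/δ)`, the zero-start energy exceeds `5 m L τ` for some `τ` with probability at most `exp
(-L)`. A union bound over `τ` is avoided by a maximal inequality of ergodic type. The process is not
stationary, so bad windows are averaged over their starting time `k`. The process restarted from
zero at `k` is the average of the true output and of the output with all noise before `k` negated.
These two have the same law, so a restarted bad window costs only a factor two
(`output_shift_eq_average`, `measure_output_eq`). For `g = exp (3/10 ‖y‖²/m) - 1`, Jensen gives mean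
at most `0.582` in every dimension, while its average over a bad window is at least `exp (3L/2) -
1`. A greedy covering (`sum_Ico_ite_le_sum`) turns this into the tail bound. Independence of `x₁`
from the noise gives the conditional form.

Unstable case. One output suffices. An eigenvector with eigenvalue of modulus at least `1 + εa`,
together with observability, gives a real direction in which `C Aᵏ` has gain of order `(1 + εa)ᵏ
εc`. The first process noise enters a later output through `C Aᵏ`, independently of everything else,
so a scalar projection of that output has a bounded density and is rarely small
(`measure_sq_norm_output_lt_le`). The threshold is only linear in the horizon and in the dimensions,
so a logarithmic horizon is enough (`exists_horizon`). -/

theorem tendsto_pow_zero_of_spectralRadius_lt_one {A : Type*} [NormedRing A] [NormedAlgebra ℂ A]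
    [CompleteSpace A] (a : A) (h : spectralRadius ℂ a < 1) :
    Tendsto (fun n : ℕ => a ^ n) atTop (𝓝 0) := by
  obtain ⟨r, hr, hr1⟩ := exists_between h
  lift r to NNReal using (hr1.trans ENNReal.one_lt_top).ne
  have hr1' : r < 1 := by exact_mod_cast hr1
  have hev := (spectrum.pow_nnnorm_pow_one_div_tendsto_nhds_spectralRadius a).eventually_lt_const hr
  have hb : ∀ᶠ n : ℕ in atTop, ‖a ^ n‖ ≤ (r : ℝ) ^ n := by
    filter_upwards [hev, eventually_gt_atTop 0] with n hn hn0
    have hn0' : (0 : ℝ) < n := by exact_mod_cast hn0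
    have h1 : (‖a ^ n‖₊ : ENNReal) ≤ (r : ENNReal) ^ (n : ℝ) := by
      rw [one_div] at hn
      have := (ENNReal.rpow_inv_le_iff hn0').1 hn.le
      exact this
    rw [ENNReal.rpow_natCast] at h1
    have h2 : ‖a ^ n‖₊ ≤ r ^ n := by exact_mod_cast h1
    exact_mod_cast h2
  exact squeeze_zero_norm' hb
    (tendsto_pow_atTop_nhds_zero_of_lt_one r.coe_nonneg (by exact_mod_cast hr1'))

namespace LinSys

variable {dx du dy : ℕ}

/-- The spectral radius is complex, so decay holds for powers of the complexified matrix; taking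
real parts entrywise returns to `A`. -/
theorem Stable.tendsto_pow {s : LinSys dx du dy} (h : s.Stable) :
    Tendsto (fun n : ℕ => s.A ^ n) atTop (𝓝 0) := by
  have h1 := tendsto_pow_zero_of_spectralRadius_lt_one _ h
  have h2 : ∀ n, s.A ^ n = ((s.A.map (fun r : ℝ => (r : ℂ))) ^ n).map Complex.re := by
    intro n
    have : (s.A.map (fun r : ℝ => (r : ℂ))) ^ n = (s.A ^ n).map (fun r : ℝ => (r : ℂ)) :=
      (Matrix.map_pow s.A Complex.ofRealHom n).symm
    rw [this]
    ext i j
    simp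
  simp_rw [h2]
  have h3 : Continuous (fun X : Matrix (Fin dx) (Fin dx) ℂ => X.map Complex.re) :=
    Continuous.matrix_map continuous_id Complex.continuous_re
  have := (h3.tendsto 0).comp h1
  simpa [Function.comp_def] using this

/-- Conjugating `CᵀC = P - AᵀPA` by `Aʲ` makes the series telescope. -/
theorem IsLyapunovSolution.sum_range {s : LinSys dx du dy} {P : Matrix (Fin dx) (Fin dx) ℝ}
    (h : s.IsLyapunovSolution P) (n : ℕ) :
    ∑ j ∈ Finset.range n, (s.C * s.A ^ j)ᵀ * (s.C * s.A ^ j)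
      = P - (s.A ^ n)ᵀ * P * s.A ^ n := by
  induction n with
  | zero => simp
  | succ n ih =>
    have hC : s.Cᵀ * s.C = P - s.Aᵀ * P * s.A := by
      have := h
      unfold IsLyapunovSolution at this
      rw [← sub_eq_zero, ← this]; abel
    rw [Finset.sum_range_succ, ih, pow_succ']
    have : (s.C * s.A ^ n)ᵀ * (s.C * s.A ^ n) = (s.A ^ n)ᵀ * (s.Cᵀ * s.C) * s.A ^ n := by
      simp only [Matrix.transpose_mul, Matrix.mul_assoc]
    rw [this, hC]
    simp only [Matrix.transpose_mul, Matrix.mul_assoc, Matrix.mul_sub, Matrix.sub_mul]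
    abel

theorem Stable.tendsto_conj_pow {s : LinSys dx du dy} (hs : s.Stable)
    (P : Matrix (Fin dx) (Fin dx) ℝ) :
    Tendsto (fun n : ℕ => (s.A ^ n)ᵀ * P * s.A ^ n) atTop (𝓝 0) := by
  have h3 : Continuous (fun X : Matrix (Fin dx) (Fin dx) ℝ => Xᵀ * P * X) := by fun_prop
  simpa [Function.comp_def] using (h3.tendsto 0).comp hs.tendsto_pow

theorem IsLyapunovSolution.tendsto_sum {s : LinSys dx du dy} {P : Matrix (Fin dx) (Fin dx) ℝ}
    (h : s.IsLyapunovSolution P) (hs : s.Stable) :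
    Tendsto (fun n => ∑ j ∈ Finset.range n, (s.C * s.A ^ j)ᵀ * (s.C * s.A ^ j)) atTop (𝓝 P) := by
  simp_rw [h.sum_range]
  simpa using tendsto_const_nhds.sub (hs.tendsto_conj_pow P)

theorem IsLyapunovSolution.unique {s : LinSys dx du dy} {P Q : Matrix (Fin dx) (Fin dx) ℝ}
    (h : s.IsLyapunovSolution P) (h' : s.IsLyapunovSolution Q) (hs : s.Stable) : P = Q :=
  tendsto_nhds_unique (h.tendsto_sum hs) (h'.tendsto_sum hs)

/-- In finite dimension injectivity of `X ↦ AᵀXA - X` is enough: a fixed point of `X ↦ AᵀXA` equals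
all its iterates, which tend to zero. -/
theorem Stable.exists_isLyapunovSolution {s : LinSys dx du dy} (hs : s.Stable) :
    ∃ P, s.IsLyapunovSolution P := by
  let f : Matrix (Fin dx) (Fin dx) ℝ →ₗ[ℝ] Matrix (Fin dx) (Fin dx) ℝ :=
    { toFun := fun X => s.Aᵀ * X * s.A - X
      map_add' := fun X Y => by simp only [Matrix.mul_add, Matrix.add_mul]; abel
      map_smul' := fun c X => by simp [smul_sub] }
  have hinj : Function.Injective f := by
    rw [injective_iff_map_eq_zero]
    intro X hX
    have hX' : s.Aᵀ * X * s.A = X := sub_eq_zero.1 hX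
    have hpow : ∀ n : ℕ, (s.A ^ n)ᵀ * X * s.A ^ n = X := by
      intro n
      induction n with
      | zero => simp
      | succ n ih =>
        calc (s.A ^ (n + 1))ᵀ * X * s.A ^ (n + 1)
            = (s.A ^ n)ᵀ * (s.Aᵀ * X * s.A) * s.A ^ n := by
              rw [pow_succ']; simp only [Matrix.transpose_mul, Matrix.mul_assoc]
          _ = X := by rw [hX', ih]
    have := hs.tendsto_conj_pow X
    simp_rw [hpow] at this
    exact tendsto_nhds_unique tendsto_const_nhds this
  obtain ⟨P, hP⟩ := LinearMap.injective_iff_surjective.1 hinj (-(s.Cᵀ * s.C))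
  refine ⟨P, ?_⟩
  have hP' : s.Aᵀ * P * s.A - P = -(s.Cᵀ * s.C) := hP
  simp [IsLyapunovSolution, hP']

/-- A linear functional that is nonnegative on Gram matrices is, on the Lyapunov solution, at least
its value on the partial sums of the Gramian series. -/
theorem IsLyapunovSolution.sum_le {s : LinSys dx du dy} {P : Matrix (Fin dx) (Fin dx) ℝ}
    (h : s.IsLyapunovSolution P) (hs : s.Stable) (φ : Matrix (Fin dx) (Fin dx) ℝ →ₗ[ℝ] ℝ)
    (hφ : ∀ H : Matrix (Fin dy) (Fin dx) ℝ, 0 ≤ φ (Hᵀ * H)) (n : ℕ) :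
    ∑ j ∈ Finset.range n, φ ((s.C * s.A ^ j)ᵀ * (s.C * s.A ^ j)) ≤ φ P := by
  have hc : Continuous φ := φ.continuous_of_finiteDimensional
  have ht := (hc.tendsto P).comp (h.tendsto_sum hs)
  have hm : Monotone (fun n => ∑ j ∈ Finset.range n, φ ((s.C * s.A ^ j)ᵀ * (s.C * s.A ^ j))) :=
    monotone_nat_of_le_succ fun n => by
      rw [Finset.sum_range_succ]
      linarith [hφ (s.C * s.A ^ n)]
  refine hm.ge_of_tendsto ?_ n
  simpa [Function.comp_def] using ht

theorem IsLyapunovSolution.sum_sq_norm_le {s : LinSys dx du dy} {P : Matrix (Fin dx) (Fin dx) ℝ}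
    (h : s.IsLyapunovSolution P) (hs : s.Stable) (v : EuclideanSpace ℝ (Fin dx)) (n : ℕ) :
    ∑ j ∈ Finset.range n, ‖Matrix.toEuclideanLin (s.C * s.A ^ j) v‖ ^ 2
      ≤ inner ℝ v (Matrix.toEuclideanLin P v) := by
  let φ : Matrix (Fin dx) (Fin dx) ℝ →ₗ[ℝ] ℝ :=
    { toFun := fun X => inner ℝ v (Matrix.toEuclideanLin X v)
      map_add' := fun X Y => by simp [inner_add_right]
      map_smul' := fun c X => by simp [inner_smul_right] }
  have key : ∀ H : Matrix (Fin dy) (Fin dx) ℝ, φ (Hᵀ * H) = ‖Matrix.toEuclideanLin H v‖ ^ 2 := by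
    intro H
    change inner ℝ v (Matrix.toEuclideanLin (Hᵀ * H) v) = _
    rw [← real_inner_self_eq_norm_sq]
    simp only [EuclideanSpace.inner_eq_star_dotProduct, Matrix.toLpLin_apply, star_trivial]
    rw [← Matrix.mulVec_mulVec, Matrix.mulVec_transpose, ← Matrix.dotProduct_mulVec]
  have := h.sum_le hs φ (fun H => by rw [key]; positivity) n
  simp only [key] at this
  exact this

theorem sum_sq_eq_trace {m n : ℕ} (H : Matrix (Fin m) (Fin n) ℝ) :
    ∑ i, ∑ k, H i k ^ 2 = (Hᵀ * H).trace := by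
  simp only [Matrix.trace, Matrix.diag, Matrix.mul_apply, Matrix.transpose_apply]
  rw [Finset.sum_comm]
  simp [sq]

/-- Bounds summed output variances: `B = 1` serves the process noise, and `B = s.B` the input. -/
theorem IsLyapunovSolution.sum_sq_entries_le {s : LinSys dx du dy} {P : Matrix (Fin dx) (Fin dx) ℝ}
    (h : s.IsLyapunovSolution P) (hs : s.Stable) {m : ℕ} (B : Matrix (Fin dx) (Fin m) ℝ) (n : ℕ) :
    ∑ j ∈ Finset.range n, ∑ i, ∑ k, (s.C * s.A ^ j * B) i k ^ 2 ≤ (Bᵀ * P * B).trace := by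
  let φ : Matrix (Fin dx) (Fin dx) ℝ →ₗ[ℝ] ℝ :=
    { toFun := fun X => (Bᵀ * X * B).trace
      map_add' := fun X Y => by simp [Matrix.mul_add, Matrix.add_mul]
      map_smul' := fun c X => by simp }
  have key : ∀ H : Matrix (Fin dy) (Fin dx) ℝ, φ (Hᵀ * H) = ∑ i, ∑ k, (H * B) i k ^ 2 := by
    intro H
    change (Bᵀ * (Hᵀ * H) * B).trace = _
    rw [sum_sq_eq_trace, Matrix.transpose_mul]
    simp only [Matrix.mul_assoc]
  have := h.sum_le hs φ (fun H => by rw [key]; positivity) n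
  simp only [key] at this
  exact this

end LinSys

/-! ### Gaussian tools: exponential moments of squared norms, small-ball bounds -/

section GaussianTools

variable {Ω : Type*} [MeasurableSpace Ω] {μ : Measure Ω}

theorem posSemidef_sq_smul_one (n : ℕ) (σ : ℝ) :
    (σ ^ 2 • (1 : Matrix (Fin n) (Fin n) ℝ)).PosSemidef :=
  Matrix.PosSemidef.one.smul (sq_nonneg σ)

theorem hasLaw_inner_of_isotropic {n : ℕ} {σ : ℝ} {X : Ω → EuclideanSpace ℝ (Fin n)}
    (hX : HasLaw X (multivariateGaussian 0 (σ ^ 2 • 1)) μ) (a : EuclideanSpace ℝ (Fin n)) :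
    HasLaw (fun ω => inner ℝ a (X ω)) (gaussianReal 0 (σ ^ 2 * ‖a‖ ^ 2).toNNReal) μ := by
  have h1 : HasLaw (innerSL ℝ a) (gaussianReal 0 (σ ^ 2 * ‖a‖ ^ 2).toNNReal)
      (multivariateGaussian 0 (σ ^ 2 • (1 : Matrix (Fin n) (Fin n) ℝ))) := by
    refine ⟨by fun_prop, ?_⟩
    rw [IsGaussian.map_eq_gaussianReal]
    congr 1
    · rw [ContinuousLinearMap.integral_comp_id_comm IsGaussian.integrable_id]
      simp
    · have h2 := covarianceBilin_self (μ := multivariateGaussian 0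
        (σ ^ 2 • (1 : Matrix (Fin n) (Fin n) ℝ))) IsGaussian.memLp_two_id a
      rw [covarianceBilin_multivariateGaussian (posSemidef_sq_smul_one n σ)] at h2
      congr 1
      change Var[fun u => inner ℝ a u; _] = _
      rw [← h2, ← real_inner_self_eq_norm_sq, EuclideanSpace.inner_eq_star_dotProduct]
      simp [Matrix.smul_mulVec]
  exact h1.comp hX

theorem hasLaw_toEuclideanLin_apply {m n : ℕ} {σ : ℝ} {X : Ω → EuclideanSpace ℝ (Fin n)}
    (hX : HasLaw X (multivariateGaussian 0 (σ ^ 2 • 1)) μ) (H : Matrix (Fin m) (Fin n) ℝ)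
    (i : Fin m) :
    HasLaw (fun ω => Matrix.toEuclideanLin H (X ω) i)
      (gaussianReal 0 (σ ^ 2 * ∑ k, H i k ^ 2).toNNReal) μ := by
  have h := hasLaw_inner_of_isotropic hX (WithLp.toLp 2 (H i))
  rw [EuclideanSpace.real_norm_sq_eq] at h
  convert h using 2 with ω
  simp [Matrix.mulVec, EuclideanSpace.inner_eq_star_dotProduct, dotProduct_comm]

theorem hasLaw_finsetSum_gaussianReal {ι : Type*} {R : ι → Ω → ℝ} {v : ι → NNReal}
    [IsProbabilityMeasure μ]
    (hR : iIndepFun R μ) (hm : ∀ i, Measurable (R i))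
    (hl : ∀ i, HasLaw (R i) (gaussianReal 0 (v i)) μ) (s : Finset ι) :
    HasLaw (fun ω => ∑ i ∈ s, R i ω) (gaussianReal 0 (∑ i ∈ s, v i)) μ := by
  classical
  induction s using Finset.induction_on with
  | empty =>
    simp only [Finset.sum_empty, gaussianReal_zero_var]
    exact hasLaw_dirac_of_ae_eq (ae_of_all _ fun _ => rfl)
  | insert i s hi ih =>
    have hind : IndepFun (R i) (fun ω => ∑ j ∈ s, R j ω) μ := by
      have := (hR.indepFun_finsetSum_of_notMem hm hi).symm
      convert this using 1
      ext ω; simp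
    refine ⟨(Finset.measurable_sum _ fun i _ => hm i).aemeasurable, ?_⟩
    have := gaussianReal_add_gaussianReal_of_indepFun hind (hl i).map_eq ih.map_eq
    rw [Finset.sum_insert hi, ← zero_add (0 : ℝ), ← this]
    congr 1
    ext ω
    simp [Finset.sum_insert hi]

theorem integrable_exp_sq_gaussianReal {c : ℝ} (hc : c < 1 / 2) :
    Integrable (fun x => Real.exp (c * x ^ 2)) (gaussianReal 0 1) ∧
      ∫ x, Real.exp (c * x ^ 2) ∂(gaussianReal 0 1) = (√(1 - 2 * c))⁻¹ := by
  have hpdf : ∀ x : ℝ, gaussianPDFReal 0 1 x * Real.exp (c * x ^ 2)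
      = (√(2 * Real.pi))⁻¹ * Real.exp (-(1 / 2 - c) * x ^ 2) := by
    intro x
    simp only [gaussianPDFReal, NNReal.coe_one, mul_one, sub_zero]
    rw [mul_assoc, ← Real.exp_add]
    congr 2
    ring
  have hb : 0 < 1 / 2 - c := by linarith
  constructor
  · rw [gaussianReal_of_var_ne_zero _ one_ne_zero, gaussianPDF_def,
      integrable_withDensity_iff_integrable_smul']
    · refine ((integrable_exp_neg_mul_sq hb).const_mul (√(2 * Real.pi))⁻¹).congr
        (ae_of_all _ fun x => ?_)
      simp only [smul_eq_mul]
      rw [ENNReal.toReal_ofReal (gaussianPDFReal_nonneg _ _ _), hpdf]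
    · exact (measurable_gaussianPDFReal 0 1).ennreal_ofReal
    · exact ae_of_all _ fun x => ENNReal.ofReal_lt_top
  · rw [integral_gaussianReal_eq_integral_smul one_ne_zero]
    simp only [smul_eq_mul, hpdf]
    rw [integral_const_mul, integral_gaussian, ← Real.sqrt_inv, ← Real.sqrt_inv,
      ← Real.sqrt_mul (by positivity)]
    congr 1
    have : 1 - 2 * c ≠ 0 := by linarith
    have h2 : (1 / 2 - c) ≠ 0 := hb.ne'
    field_simp

theorem inv_sqrt_two_fifths_le : (√(1 - 2 * (3 / 10 : ℝ)))⁻¹ ≤ 1.582 := by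
  rw [inv_le_comm₀ (by positivity) (by norm_num)]
  apply Real.le_sqrt_of_sq_le
  norm_num

/-- The comparison value is the standard Gaussian moment `1/√(1 - 2·3/10) ≈ 1.5811`. Writing the law
as a scaled standard Gaussian also covers `v = 0`. -/
theorem integrable_exp_sq_div {Y : Ω → ℝ} {v : NNReal} {r : ℝ}
    (hY : HasLaw Y (gaussianReal 0 v) μ) (hr : 0 < r) (hv : v ≤ r) :
    Integrable (fun ω => Real.exp (3 / 10 * (Y ω ^ 2 / r))) μ ∧
      ∫ ω, Real.exp (3 / 10 * (Y ω ^ 2 / r)) ∂μ ≤ 1.582 := by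
  obtain ⟨hi1, he1⟩ := integrable_exp_sq_gaussianReal (c := 3 / 10) (by norm_num)
  have hmap : gaussianReal 0 v = (gaussianReal 0 1).map (fun x => √v * x) := by
    rw [gaussianReal_map_const_mul]
    congr 1
    · simp
    · ext; simp
  let f : ℝ → ℝ := fun y => Real.exp (3 / 10 * (y ^ 2 / r))
  have hfm : Measurable f := by fun_prop
  have hle : ∀ x : ℝ, f (√v * x) ≤ Real.exp (3 / 10 * x ^ 2) := by
    intro x
    apply Real.exp_le_exp.2
    have : (√v * x) ^ 2 / r ≤ x ^ 2 := by
      rw [mul_pow, Real.sq_sqrt v.coe_nonneg, div_le_iff₀ hr]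
      nlinarith [sq_nonneg x]
    linarith
  have hi2 : Integrable (fun x => f (√v * x)) (gaussianReal 0 1) := by
    refine hi1.mono (by fun_prop) (ae_of_all _ fun x => ?_)
    rw [Real.norm_eq_abs, Real.norm_eq_abs, abs_of_pos (Real.exp_pos _),
      abs_of_pos (Real.exp_pos _)]
    exact hle x
  have hi3 : Integrable f (gaussianReal 0 v) := by
    rw [hmap, integrable_map_measure hfm.aestronglyMeasurable (by fun_prop)]
    exact hi2
  constructor
  · have := hi3
    rw [← hY.map_eq, integrable_map_measure hfm.aestronglyMeasurable hY.aemeasurable] at this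
    exact this
  · have h1 : ∫ ω, f (Y ω) ∂μ = ∫ x, f x ∂(gaussianReal 0 v) :=
      hY.integral_comp hfm.aestronglyMeasurable
    change ∫ ω, f (Y ω) ∂μ ≤ _
    rw [h1, hmap, integral_map (by fun_prop) hfm.aestronglyMeasurable]
    exact (integral_mono hi2 hi1 hle).trans (he1.le.trans inv_sqrt_two_fifths_le)

/-- `‖Y‖²/m` is a weighted mean of the normalized squares `Yᵢ²/rᵢ`, so convexity of `exp` reduces to
single coordinates. The coordinates need not be independent, and the bound is free of the dimension.
-/
theorem integral_exp_norm_sq_sub_one_le {n : ℕ} [IsProbabilityMeasure μ]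
    {Y : Ω → EuclideanSpace ℝ (Fin n)} (hYm : Measurable Y) {v : Fin n → NNReal} {m : ℝ}
    (hY : ∀ i, HasLaw (fun ω => Y ω i) (gaussianReal 0 (v i)) μ)
    (hm : ∑ i, (v i : ℝ) < m) :
    Integrable (fun ω => Real.exp (3 / 10 * (‖Y ω‖ ^ 2 / m)) - 1) μ ∧
      ∫ ω, (Real.exp (3 / 10 * (‖Y ω‖ ^ 2 / m)) - 1) ∂μ ≤ 0.582 := by
  have hm0 : 0 < m := lt_of_le_of_lt (Finset.sum_nonneg fun i _ => (v i).coe_nonneg) hm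
  -- The slack in `m` is spread over the coordinates so that every `rᵢ` is positive even for zero
  -- variances; `n + 1` covers `n = 0`.
  set e : ℝ := (m - ∑ i, (v i : ℝ)) / (n + 1) with he
  have he0 : 0 < e := div_pos (by linarith) (by positivity)
  set r : Fin n → ℝ := fun i => v i + e with hr
  have hr0 : ∀ i, 0 < r i := fun i => add_pos_of_nonneg_of_pos (v i).coe_nonneg he0
  have hrs : ∑ i, r i ≤ m := by
    simp only [hr, Finset.sum_add_distrib, Finset.sum_const, Finset.card_univ, Fintype.card_fin,
      nsmul_eq_mul]
    have : (n + 1 : ℝ) * e = m - ∑ i, (v i : ℝ) := by rw [he]; field_simp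
    linarith
  have hw : ∑ i, r i / m ≤ 1 := by
    rw [← Finset.sum_div, div_le_one hm0]; exact hrs
  have hE := fun i => integrable_exp_sq_div (hY i) (hr0 i) (by simp only [hr]; linarith)
  have hpt : ∀ ω, Real.exp (3 / 10 * (‖Y ω‖ ^ 2 / m)) - 1
      ≤ ∑ i, r i / m * (Real.exp (3 / 10 * (Y ω i ^ 2 / r i)) - 1) := by
    intro ω
    -- The leftover weight `1 - ∑ rᵢ/m` sits at the point `0`.
    have h := convexOn_exp.map_add_sum_le (t := Finset.univ) (w := fun i => r i / m)
      (p := fun i => 3 / 10 * (Y ω i ^ 2 / r i)) (v := 1 - ∑ i, r i / m) (q := 0)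
      (fun i _ => by have := hr0 i; positivity) (by ring) (fun _ _ => Set.mem_univ _)
      (by linarith) (Set.mem_univ _)
    have h2 : (1 - ∑ i, r i / m) • (0 : ℝ) + ∑ i, (r i / m) • (3 / 10 * (Y ω i ^ 2 / r i))
        = 3 / 10 * (‖Y ω‖ ^ 2 / m) := by
      rw [EuclideanSpace.real_norm_sq_eq, smul_zero, zero_add, Finset.sum_div, Finset.mul_sum]
      refine Finset.sum_congr rfl fun i _ => ?_
      have := (hr0 i).ne'
      rw [smul_eq_mul]
      field_simp
    rw [h2] at h
    simp only [smul_eq_mul, Real.exp_zero, mul_one] at h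
    simp only [mul_sub, mul_one, Finset.sum_sub_distrib]
    linarith
  have hint : Integrable
      (fun ω => ∑ i, r i / m * (Real.exp (3 / 10 * (Y ω i ^ 2 / r i)) - 1)) μ :=
    integrable_finsetSum _ fun i _ => ((hE i).1.sub (integrable_const 1)).const_mul _
  have hnn : ∀ ω, 0 ≤ Real.exp (3 / 10 * (‖Y ω‖ ^ 2 / m)) - 1 := by
    intro ω
    have := Real.one_le_exp (show 0 ≤ 3 / 10 * (‖Y ω‖ ^ 2 / m) by positivity)
    linarith
  have hint2 : Integrable (fun ω => Real.exp (3 / 10 * (‖Y ω‖ ^ 2 / m)) - 1) μ := by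
    refine hint.mono (Measurable.aestronglyMeasurable (by fun_prop)) (ae_of_all _ fun ω => ?_)
    rw [Real.norm_eq_abs, Real.norm_eq_abs, abs_of_nonneg (hnn ω)]
    exact (hpt ω).trans (le_abs_self _)
  refine ⟨hint2, (integral_mono hint2 hint hpt).trans ?_⟩
  have hint3 : ∀ i ∈ Finset.univ, Integrable
      (fun ω => r i / m * (Real.exp (3 / 10 * (Y ω i ^ 2 / r i)) - 1)) μ :=
    fun i _ => ((hE i).1.sub (integrable_const 1)).const_mul _
  rw [integral_finsetSum _ hint3]
  calc ∑ i, ∫ ω, r i / m * (Real.exp (3 / 10 * (Y ω i ^ 2 / r i)) - 1) ∂μ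
      ≤ ∑ i, r i / m * 0.582 := by
        refine Finset.sum_le_sum fun i _ => ?_
        rw [integral_const_mul, integral_sub (hE i).1 (integrable_const 1)]
        refine mul_le_mul_of_nonneg_left ?_ (by have := hr0 i; positivity)
        have := (hE i).2
        simp only [integral_const, probReal_univ, smul_eq_mul, mul_one]
        linarith
    _ ≤ 0.582 := by
        rw [← Finset.sum_mul]
        nlinarith

/-- Peak of the density times the length of the interval, uniformly in the centre `c`. -/
theorem gaussianReal_abs_add_lt_le {v : NNReal} (hv : v ≠ 0) (c r : ℝ) :
    gaussianReal 0 v {x | |x + c| < r} ≤ ENNReal.ofReal (2 * r / √(2 * Real.pi * v)) := by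
  have hset : {x : ℝ | |x + c| < r} = Set.Ioo (-r - c) (r - c) := by
    ext x
    simp only [Set.mem_ofPred_eq, abs_lt, Set.mem_Ioo]
    constructor <;> rintro ⟨h1, h2⟩ <;> constructor <;> linarith
  rw [gaussianReal_apply _ hv, hset]
  calc ∫⁻ x in Set.Ioo (-r - c) (r - c), gaussianPDF 0 v x
      ≤ ∫⁻ _ in Set.Ioo (-r - c) (r - c), ENNReal.ofReal (√(2 * Real.pi * v))⁻¹ := by
        refine lintegral_mono fun x => ENNReal.ofReal_le_ofReal ?_
        rw [gaussianPDFReal]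
        refine mul_le_of_le_one_right (by positivity) (Real.exp_le_one_iff.2 ?_)
        apply div_nonpos_of_nonpos_of_nonneg
        · nlinarith [sq_nonneg (x - 0)]
        · positivity
    _ = ENNReal.ofReal (2 * r / √(2 * Real.pi * v)) := by
        rw [lintegral_const, Measure.restrict_apply_univ, Real.volume_Ioo,
          ← ENNReal.ofReal_mul (by positivity)]
        congr 1
        field_simp
        ring

theorem measure_abs_add_lt_le_of_indepFun [IsProbabilityMeasure μ] {G R : Ω → ℝ} {v : NNReal}
    (hv : v ≠ 0) (hG : HasLaw G (gaussianReal 0 v) μ) (hR : Measurable R)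
    (hGR : IndepFun G R μ) (r : ℝ) :
    μ {ω | |G ω + R ω| < r} ≤ ENNReal.ofReal (2 * r / √(2 * Real.pi * v)) := by
  have hmap := (indepFun_iff_map_prod_eq_prod_map_map hG.aemeasurable hR.aemeasurable).1 hGR
  have hS : MeasurableSet {p : ℝ × ℝ | |p.1 + p.2| < r} :=
    measurableSet_lt (by fun_prop) measurable_const
  have := Measure.isProbabilityMeasure_map (μ := μ) hR.aemeasurable
  have h1 : μ {ω | |G ω + R ω| < r}
      = ((gaussianReal 0 v).prod (μ.map R)) {p : ℝ × ℝ | |p.1 + p.2| < r} := by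
    rw [← hG.map_eq, ← hmap,
      Measure.map_apply_of_aemeasurable (hG.aemeasurable.prodMk hR.aemeasurable) hS]
    rfl
  rw [h1, Measure.prod_apply_symm hS]
  calc ∫⁻ y, gaussianReal 0 v ((fun x => (x, y)) ⁻¹' {p : ℝ × ℝ | |p.1 + p.2| < r}) ∂(μ.map R)
      ≤ ∫⁻ _, ENNReal.ofReal (2 * r / √(2 * Real.pi * v)) ∂(μ.map R) :=
        lintegral_mono fun y => gaussianReal_abs_add_lt_le hv y r
    _ = _ := by simp

end GaussianTools

theorem hasLaw_neg_of_isotropic {Ω : Type*} [MeasurableSpace Ω] {μ : Measure Ω} {n : ℕ} {σ : ℝ}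
    {X : Ω → EuclideanSpace ℝ (Fin n)}
    (hX : HasLaw X (multivariateGaussian 0 (σ ^ 2 • 1)) μ) :
    HasLaw (-X) (multivariateGaussian 0 (σ ^ 2 • 1)) μ := by
  have h : HasLaw (fun x => -x) (multivariateGaussian 0 (σ ^ 2 • (1 : Matrix (Fin n) (Fin n) ℝ)))
      (multivariateGaussian 0 (σ ^ 2 • (1 : Matrix (Fin n) (Fin n) ℝ))) := by
    refine ⟨by fun_prop, ?_⟩
    have hp := Measure.isProbabilityMeasure_map
      (μ := multivariateGaussian 0 (σ ^ 2 • (1 : Matrix (Fin n) (Fin n) ℝ)))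
      (f := fun x => -x) (by fun_prop)
    apply Measure.ext_of_charFun
    ext t
    have h1 := charFun_map_smul (μ := multivariateGaussian 0
      (σ ^ 2 • (1 : Matrix (Fin n) (Fin n) ℝ))) (-1) t
    simp only [neg_smul, one_smul] at h1
    rw [h1, charFun_multivariateGaussian (posSemidef_sq_smul_one n σ),
      charFun_multivariateGaussian (posSemidef_sq_smul_one n σ)]
    simp [Matrix.mulVec_neg]
  exact h.comp hX

/-! ### Superposition, time shift and sign change for states and outputs -/

namespace LinSys

variable {dx du dy : ℕ} {Ω : Type*} (s : LinSys dx du dy)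
  (x₁ : Ω → EuclideanSpace ℝ (Fin dx)) (w : ℕ → Ω → EuclideanSpace ℝ (Fin dx))
  (u : ℕ → Ω → EuclideanSpace ℝ (Fin du)) (η : ℕ → Ω → EuclideanSpace ℝ (Fin dy))

theorem toEuclideanLin_mul_apply {l m n : ℕ} (X : Matrix (Fin l) (Fin m) ℝ)
    (Y : Matrix (Fin m) (Fin n) ℝ) (v : EuclideanSpace ℝ (Fin n)) :
    Matrix.toEuclideanLin (X * Y) v = Matrix.toEuclideanLin X (Matrix.toEuclideanLin Y v) := by
  simp [Matrix.toLpLin_apply]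

theorem toEuclideanLin_pow_succ_apply {m : ℕ} (X : Matrix (Fin m) (Fin m) ℝ) (t : ℕ)
    (v : EuclideanSpace ℝ (Fin m)) :
    Matrix.toEuclideanLin X (Matrix.toEuclideanLin (X ^ t) v)
      = Matrix.toEuclideanLin (X ^ (t + 1)) v := by
  rw [pow_succ', toEuclideanLin_mul_apply]

theorem toEuclideanLin_one_apply {m : ℕ} (v : EuclideanSpace ℝ (Fin m)) :
    Matrix.toEuclideanLin (1 : Matrix (Fin m) (Fin m) ℝ) v = v := by
  simp

theorem state_eq_pow_add (t : ℕ) (ω : Ω) :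
    s.state x₁ w u t ω = Matrix.toEuclideanLin (s.A ^ t) (x₁ ω) + s.state 0 w u t ω := by
  induction t with
  | zero => simp [state]
  | succ t ih =>
    simp only [state]
    rw [ih, map_add, toEuclideanLin_pow_succ_apply]
    abel

theorem output_eq_pow_add (t : ℕ) (ω : Ω) :
    s.output x₁ w u η t ω
      = Matrix.toEuclideanLin (s.C * s.A ^ t) (x₁ ω) + s.output 0 w u η t ω := by
  simp only [output]
  rw [state_eq_pow_add, map_add, toEuclideanLin_mul_apply]
  abel

theorem state_shift (k t : ℕ) (ω : Ω) :
    s.state 0 w u (k + t) ω = Matrix.toEuclideanLin (s.A ^ t) (s.state 0 w u k ω)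
      + s.state 0 (fun j => w (k + j)) (fun j => u (k + j)) t ω := by
  induction t with
  | zero => simp [state]
  | succ t ih =>
    rw [← add_assoc]
    simp only [state]
    rw [ih, map_add, toEuclideanLin_pow_succ_apply]
    abel

theorem output_shift (k t : ℕ) (ω : Ω) :
    s.output 0 w u η (k + t) ω = Matrix.toEuclideanLin (s.C * s.A ^ t) (s.state 0 w u k ω)
      + s.output 0 (fun j => w (k + j)) (fun j => u (k + j)) (fun j => η (k + j)) t ω := by
  simp only [output]
  rw [state_shift, map_add, toEuclideanLin_mul_apply]
  abel

/-- The sequence `f` with the sign of its first `k` terms changed. -/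
def negBefore {E : Type*} [Neg E] (k : ℕ) (f : ℕ → Ω → E) : ℕ → Ω → E :=
  fun j => if j < k then -f j else f j

theorem state_negBefore (k j : ℕ) (hj : j ≤ k) (ω : Ω) :
    s.state 0 (negBefore k w) (negBefore k u) j ω = -s.state 0 w u j ω := by
  induction j with
  | zero => simp [state]
  | succ j ih =>
    have h : j < k := hj
    simp only [state, negBefore]
    rw [ih h.le]
    simp only [h, if_true, Pi.neg_apply, map_neg]
    abel

theorem negBefore_shift {E : Type*} [Neg E] (k : ℕ) (f : ℕ → Ω → E) :
    (fun j => negBefore k f (k + j)) = fun j => f (k + j) := by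
  funext j
  simp [negBefore]

/-- The zero-start output driven by the shifted noise is the average of the shifted outputs under
the noise and under the noise with the past negated. -/
theorem output_shift_eq_average (k t : ℕ) (ω : Ω) :
    (2 : ℝ) • s.output 0 (fun j => w (k + j)) (fun j => u (k + j)) (fun j => η (k + j)) t ω
      = s.output 0 w u η (k + t) ω
        + s.output 0 (negBefore k w) (negBefore k u) (negBefore k η) (k + t) ω := by
  rw [output_shift, output_shift, negBefore_shift, negBefore_shift, negBefore_shift,
    state_negBefore _ _ _ _ _ le_rfl, map_neg, two_smul]
  abel

theorem measurable_state [MeasurableSpace Ω] (hx : Measurable x₁) (hw : ∀ t, Measurable (w t))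
    (hu : ∀ t, Measurable (u t)) (t : ℕ) : Measurable (s.state x₁ w u t) := by
  induction t with
  | zero => exact hx
  | succ t ih =>
    have h1 : Continuous (Matrix.toEuclideanLin s.A) :=
      LinearMap.continuous_of_finiteDimensional _
    have h2 : Continuous (Matrix.toEuclideanLin s.B) :=
      LinearMap.continuous_of_finiteDimensional _
    exact ((h1.measurable.comp ih).add (h2.measurable.comp (hu t))).add (hw t)

theorem measurable_output [MeasurableSpace Ω] (hx : Measurable x₁) (hw : ∀ t, Measurable (w t))
    (hu : ∀ t, Measurable (u t)) (hη : ∀ t, Measurable (η t)) (t : ℕ) :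
    Measurable (s.output x₁ w u η t) := by
  have h1 : Continuous (Matrix.toEuclideanLin s.C) := LinearMap.continuous_of_finiteDimensional _
  exact (h1.measurable.comp (s.measurable_state x₁ w u hx hw hu t)).add (hη t)

theorem state_zero_eq_sum (t : ℕ) (ω : Ω) :
    s.state 0 w u t ω = ∑ j ∈ Finset.range t, (Matrix.toEuclideanLin (s.A ^ (t - 1 - j)) (w j ω)
      + Matrix.toEuclideanLin (s.A ^ (t - 1 - j) * s.B) (u j ω)) := by
  induction t with
  | zero => simp [state]
  | succ t ih =>
    rw [Finset.sum_range_succ]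
    simp only [state]
    rw [ih, map_sum]
    have : ∀ j ∈ Finset.range t, Matrix.toEuclideanLin s.A
        (Matrix.toEuclideanLin (s.A ^ (t - 1 - j)) (w j ω)
          + Matrix.toEuclideanLin (s.A ^ (t - 1 - j) * s.B) (u j ω))
        = Matrix.toEuclideanLin (s.A ^ (t + 1 - 1 - j)) (w j ω)
          + Matrix.toEuclideanLin (s.A ^ (t + 1 - 1 - j) * s.B) (u j ω) := by
      intro j hj
      have hj' := Finset.mem_range.1 hj
      have he : t + 1 - 1 - j = (t - 1 - j) + 1 := by omega
      rw [he, map_add, toEuclideanLin_pow_succ_apply, toEuclideanLin_mul_apply,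
        toEuclideanLin_pow_succ_apply, ← toEuclideanLin_mul_apply]
    rw [Finset.sum_congr rfl this]
    simp only [add_tsub_cancel_right, tsub_self, pow_zero, toEuclideanLin_one_apply, Matrix.one_mul]
    abel

end LinSys

/-- The σ-algebras generated by the individual noise vectors. -/
abbrev noiseSigma {Ω : Type*} {dx du dy : ℕ} (w : ℕ → Ω → EuclideanSpace ℝ (Fin dx))
    (u : ℕ → Ω → EuclideanSpace ℝ (Fin du)) (η : ℕ → Ω → EuclideanSpace ℝ (Fin dy)) :
    ℕ ⊕ ℕ ⊕ ℕ → MeasurableSpace Ω :=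
  Sum.elim (fun t : ℕ => MeasurableSpace.comap (w t) inferInstance)
      (Sum.elim (fun t : ℕ => MeasurableSpace.comap (u t) inferInstance)
        (fun t : ℕ => MeasurableSpace.comap (η t) inferInstance))

/-- The assumptions of `IsNoiseModel` that do not concern the initial state. -/
structure IsGaussianNoise {Ω : Type*} [MeasurableSpace Ω] (μ : Measure Ω) {dx du dy : ℕ}
    (σw σu ση : ℝ) (w : ℕ → Ω → EuclideanSpace ℝ (Fin dx))
    (u : ℕ → Ω → EuclideanSpace ℝ (Fin du))
    (η : ℕ → Ω → EuclideanSpace ℝ (Fin dy)) : Prop where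
  measurable_w : ∀ t, Measurable (w t)
  measurable_u : ∀ t, Measurable (u t)
  measurable_η : ∀ t, Measurable (η t)
  law_w : ∀ t, HasLaw (w t) (multivariateGaussian 0 (σw ^ 2 • 1)) μ
  law_u : ∀ t, HasLaw (u t) (multivariateGaussian 0 (σu ^ 2 • 1)) μ
  law_η : ∀ t, HasLaw (η t) (multivariateGaussian 0 (ση ^ 2 • 1)) μ
  indep : iIndep (noiseSigma w u η) μ

theorem measurable_negBefore {Ω : Type*} {_ : MeasurableSpace Ω} {n : ℕ}
    {f : ℕ → Ω → EuclideanSpace ℝ (Fin n)} (k t : ℕ) (hf : Measurable (f t)) :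
    Measurable (LinSys.negBefore k f t) := by
  unfold LinSys.negBefore
  split_ifs
  · exact hf.neg
  · exact hf

/-- All noise vectors as one family with values in a common space. -/
def noisePath {Ω : Type*} {dx du dy : ℕ} (w : ℕ → Ω → EuclideanSpace ℝ (Fin dx))
    (u : ℕ → Ω → EuclideanSpace ℝ (Fin du)) (η : ℕ → Ω → EuclideanSpace ℝ (Fin dy)) :
    ℕ ⊕ ℕ ⊕ ℕ → Ω →
      EuclideanSpace ℝ (Fin dx) × EuclideanSpace ℝ (Fin du) × EuclideanSpace ℝ (Fin dy) :=
  Sum.elim (fun t ω => (w t ω, 0, 0)) (Sum.elim (fun t ω => (0, u t ω, 0)) fun t ω => (0, 0, η t ω))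

theorem LinSys.output_eq_comp_noisePath {Ω : Type*} {dx du dy : ℕ}
    {w : ℕ → Ω → EuclideanSpace ℝ (Fin dx)} {u : ℕ → Ω → EuclideanSpace ℝ (Fin du)}
    {η : ℕ → Ω → EuclideanSpace ℝ (Fin dy)} (s : LinSys dx du dy) (t : ℕ) (ω : Ω) :
    s.output 0 w u η t ω = s.output 0 (fun j p => (p (Sum.inl j)).1)
      (fun j p => (p (Sum.inr (Sum.inl j))).2.1) (fun j p => (p (Sum.inr (Sum.inr j))).2.2) t
      (fun i => noisePath w u η i ω) := by
  have hs : s.state 0 w u t ω = s.state 0 (fun j p => (p (Sum.inl j)).1)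
      (fun j p => (p (Sum.inr (Sum.inl j))).2.1) t (fun i => noisePath w u η i ω) := by
    induction t with
    | zero => rfl
    | succ t ih =>
      simp only [LinSys.state]
      rw [ih]
      rfl
  simp only [LinSys.output]
  rw [hs]
  rfl

/-! ### Laws of the noise and of the zero-start output -/

section Noise

variable {Ω : Type*} [MeasurableSpace Ω] {μ : Measure Ω} {dx du dy : ℕ} {σw σu ση : ℝ}
  {x₁ : Ω → EuclideanSpace ℝ (Fin dx)} {w : ℕ → Ω → EuclideanSpace ℝ (Fin dx)}
  {u : ℕ → Ω → EuclideanSpace ℝ (Fin du)} {η : ℕ → Ω → EuclideanSpace ℝ (Fin dy)}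

theorem IsNoiseModel.isGaussianNoise (h : IsNoiseModel μ σw σu ση x₁ w u η) :
    IsGaussianNoise μ σw σu ση w u η where
  measurable_w := h.measurable_w
  measurable_u := h.measurable_u
  measurable_η := h.measurable_η
  law_w := h.law_w
  law_u := h.law_u
  law_η := h.law_η
  indep := h.indep.precomp (g := Sum.inr) Sum.inr_injective

theorem IsGaussianNoise.shift (h : IsGaussianNoise μ σw σu ση w u η) (k : ℕ) :
    IsGaussianNoise μ σw σu ση (fun j => w (k + j)) (fun j => u (k + j)) (fun j => η (k + j)) where
  measurable_w := fun t => h.measurable_w _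
  measurable_u := fun t => h.measurable_u _
  measurable_η := fun t => h.measurable_η _
  law_w := fun t => h.law_w _
  law_u := fun t => h.law_u _
  law_η := fun t => h.law_η _
  indep := by
    have hk : Function.Injective (k + ·) := add_right_injective k
    have := h.indep.precomp (g := Sum.map (k + ·) (Sum.map (k + ·) (k + ·)))
      (hk.sumMap (hk.sumMap hk))
    convert this using 1
    funext i
    rcases i with i | i | i <;> rfl

theorem hasLaw_negBefore {n : ℕ} {f : ℕ → Ω → EuclideanSpace ℝ (Fin n)} {σ : ℝ} (k t : ℕ)
    (hf : HasLaw (f t) (multivariateGaussian 0 (σ ^ 2 • 1)) μ) :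
    HasLaw (LinSys.negBefore k f t) (multivariateGaussian 0 (σ ^ 2 • 1)) μ := by
  unfold LinSys.negBefore
  split_ifs
  · exact hasLaw_neg_of_isotropic hf
  · exact hf

theorem IsGaussianNoise.negBefore (h : IsGaussianNoise μ σw σu ση w u η) (k : ℕ) :
    IsGaussianNoise μ σw σu ση (LinSys.negBefore k w) (LinSys.negBefore k u)
      (LinSys.negBefore k η) where
  measurable_w := fun t => measurable_negBefore k t (h.measurable_w t)
  measurable_u := fun t => measurable_negBefore k t (h.measurable_u t)
  measurable_η := fun t => measurable_negBefore k t (h.measurable_η t)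
  law_w := fun t => hasLaw_negBefore k t (h.law_w t)
  law_u := fun t => hasLaw_negBefore k t (h.law_u t)
  law_η := fun t => hasLaw_negBefore k t (h.law_η t)
  indep := by
    -- A sign change does not enlarge the σ-algebra generated by a noise vector.
    refine iIndep_of_iIndep_of_le h.indep fun i => ?_
    rcases i with i | i | i <;>
    exact (measurable_negBefore k i (comap_measurable _)).comap_le

/-- Independence forces the joint law to be the product of the marginals. `κ` is chosen before the
noise, so that any two noise families share it. -/
theorem IsGaussianNoise.exists_hasLaw_noisePath (dx du dy : ℕ) (σw σu ση : ℝ) :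
    ∃ κ : Measure (ℕ ⊕ ℕ ⊕ ℕ →
      EuclideanSpace ℝ (Fin dx) × EuclideanSpace ℝ (Fin du) × EuclideanSpace ℝ (Fin dy)),
    ∀ (w : ℕ → Ω → EuclideanSpace ℝ (Fin dx)) (u : ℕ → Ω → EuclideanSpace ℝ (Fin du))
      (η : ℕ → Ω → EuclideanSpace ℝ (Fin dy)), IsGaussianNoise μ σw σu ση w u η →
      HasLaw (fun ω i => noisePath w u η i ω) κ μ := by
  refine ⟨Measure.infinitePi (Sum.elim
    (fun _ => (multivariateGaussian 0 (σw ^ 2 • 1)).map fun x => (x, 0, 0))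
    (Sum.elim (fun _ => (multivariateGaussian 0 (σu ^ 2 • 1)).map fun x => (0, x, 0))
      (fun _ => (multivariateGaussian 0 (ση ^ 2 • 1)).map fun x => (0, 0, x)))), ?_⟩
  intro w u η h
  refine iIndepFun.hasLaw_infinitePi ?_ ?_ ?_
  · rintro (t | t | t)
    · exact HasLaw.comp (Y := fun x => (x, 0, 0)) ⟨by fun_prop, rfl⟩ (h.law_w t)
    · exact HasLaw.comp (Y := fun x => (0, x, 0)) ⟨by fun_prop, rfl⟩ (h.law_u t)
    · exact HasLaw.comp (Y := fun x => (0, 0, x)) ⟨by fun_prop, rfl⟩ (h.law_η t)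
  · rw [iIndepFun_iff_iIndep]
    refine iIndep_of_iIndep_of_le h.indep ?_
    rintro (t | t | t)
    · exact (Measurable.comp (g := fun x => (x, 0, 0)) (by fun_prop)
        (comap_measurable (w t))).comap_le
    · exact (Measurable.comp (g := fun x => (0, x, 0)) (by fun_prop)
        (comap_measurable (u t))).comap_le
    · exact (Measurable.comp (g := fun x => (0, 0, x)) (by fun_prop)
        (comap_measurable (η t))).comap_le
  · refine (measurable_pi_lambda _ ?_).aemeasurable
    rintro (t | t | t)
    · exact (h.measurable_w t).prodMk measurable_const
    · exact measurable_const.prodMk ((h.measurable_u t).prodMk measurable_const)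
    · exact measurable_const.prodMk (measurable_const.prodMk (h.measurable_η t))

/-- The law of the zero-start output sequence is determined by the noise levels. -/
theorem IsGaussianNoise.measure_output_eq {w' : ℕ → Ω → EuclideanSpace ℝ (Fin dx)}
    {u' : ℕ → Ω → EuclideanSpace ℝ (Fin du)} {η' : ℕ → Ω → EuclideanSpace ℝ (Fin dy)}
    (h : IsGaussianNoise μ σw σu ση w u η) (h' : IsGaussianNoise μ σw σu ση w' u' η')
    (s : LinSys dx du dy) {T : Set (ℕ → EuclideanSpace ℝ (Fin dy))} (hT : MeasurableSet T) :
    μ {ω | (fun t => s.output 0 w u η t ω) ∈ T} = μ {ω | (fun t => s.output 0 w' u' η' t ω) ∈ T} := by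
  obtain ⟨κ, hκ⟩ := IsGaussianNoise.exists_hasLaw_noisePath (μ := μ) dx du dy σw σu ση
  have hm : Measurable fun (p : ℕ ⊕ ℕ ⊕ ℕ →
      EuclideanSpace ℝ (Fin dx) × EuclideanSpace ℝ (Fin du) × EuclideanSpace ℝ (Fin dy)) (t : ℕ) =>
      s.output 0 (fun j p => (p (Sum.inl j)).1)
      (fun j p => (p (Sum.inr (Sum.inl j))).2.1) (fun j p => (p (Sum.inr (Sum.inr j))).2.2) t p := by
    refine measurable_pi_lambda _ fun t => s.measurable_output _ _ _ _ measurable_const ?_ ?_ ?_ t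
    all_goals intro j; fun_prop
  have h1 := (hκ w u η h).measure_eq (p := fun p => _ ∈ T) (hm hT)
  have h2 := (hκ w' u' η' h').measure_eq (p := fun p => _ ∈ T) (hm hT)
  simp only [← LinSys.output_eq_comp_noisePath] at h1 h2
  exact h1.trans h2.symm

/-- Each coordinate of the zero-start output is Gaussian, with summed variances bounded through the
Lyapunov solution. -/
theorem IsGaussianNoise.exists_hasLaw_output [IsProbabilityMeasure μ]
    (h : IsGaussianNoise μ σw σu ση w u η) {s : LinSys dx du dy} (hs : s.Stable)
    {P : Matrix (Fin dx) (Fin dx) ℝ} (hP : s.IsLyapunovSolution P) (t : ℕ) :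
    ∃ v : Fin dy → NNReal,
      (∀ i, HasLaw (fun ω => s.output 0 w u η t ω i) (gaussianReal 0 (v i)) μ) ∧
      ∑ i, (v i : ℝ) ≤ σw ^ 2 * P.trace + σu ^ 2 * (s.Bᵀ * P * s.B).trace + ση ^ 2 * dy := by
  let R : Fin dy → ℕ ⊕ ℕ ⊕ ℕ → Ω → ℝ := fun i => Sum.elim
    (fun j ω => Matrix.toEuclideanLin (s.C * s.A ^ (t - 1 - j)) (w j ω) i)
    (Sum.elim (fun j ω => Matrix.toEuclideanLin (s.C * s.A ^ (t - 1 - j) * s.B) (u j ω) i)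
      (fun j ω => Matrix.toEuclideanLin 1 (η j ω) i))
  let v : Fin dy → ℕ ⊕ ℕ ⊕ ℕ → NNReal := fun i => Sum.elim
    (fun j => (σw ^ 2 * ∑ k, (s.C * s.A ^ (t - 1 - j)) i k ^ 2).toNNReal)
    (Sum.elim (fun j => (σu ^ 2 * ∑ k, (s.C * s.A ^ (t - 1 - j) * s.B) i k ^ 2).toNNReal)
      (fun _ => (ση ^ 2 * ∑ k, (1 : Matrix (Fin dy) (Fin dy) ℝ) i k ^ 2).toNNReal))
  -- The output at `t` sees process noise and input strictly before `t`, and measurement noise only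
  -- at `t`.
  let F : Finset (ℕ ⊕ ℕ ⊕ ℕ) := (Finset.range t).disjSum ((Finset.range t).disjSum {t})
  have hcont : ∀ {m : ℕ} (H : Matrix (Fin dy) (Fin m) ℝ) (i : Fin dy),
      Measurable fun x : EuclideanSpace ℝ (Fin m) => Matrix.toEuclideanLin H x i := by
    intro m H i
    have h1 : Continuous (Matrix.toEuclideanLin H) := LinearMap.continuous_of_finiteDimensional _
    fun_prop
  have hRm : ∀ i j, Measurable (R i j) := by
    rintro i (j | j | j)
    · exact (hcont _ i).comp (h.measurable_w j)
    · exact (hcont _ i).comp (h.measurable_u j)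
    · exact (hcont _ i).comp (h.measurable_η j)
  have hRl : ∀ i j, HasLaw (R i j) (gaussianReal 0 (v i j)) μ := by
    rintro i (j | j | j)
    · exact hasLaw_toEuclideanLin_apply (h.law_w j) _ i
    · exact hasLaw_toEuclideanLin_apply (h.law_u j) _ i
    · exact hasLaw_toEuclideanLin_apply (h.law_η j) _ i
  have hRi : ∀ i, iIndepFun (R i) μ := by
    intro i
    rw [iIndepFun_iff_iIndep]
    refine iIndep_of_iIndep_of_le h.indep ?_
    rintro (j | j | j)
    · exact ((hcont _ i).comp (comap_measurable (w j))).comap_le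
    · exact ((hcont _ i).comp (comap_measurable (u j))).comap_le
    · exact ((hcont _ i).comp (comap_measurable (η j))).comap_le
  refine ⟨fun i => ∑ j ∈ F, v i j, fun i => ?_, ?_⟩
  · convert hasLaw_finsetSum_gaussianReal (hRi i) (hRm i) (hRl i) F using 2 with ω
    simp only [F, Finset.sum_disjSum, R, Sum.elim_inl, Sum.elim_inr, Finset.sum_singleton,
      LinSys.output, LinSys.toEuclideanLin_one_apply]
    rw [LinSys.state_zero_eq_sum, map_sum]
    simp only [map_add, ← LinSys.toEuclideanLin_mul_apply, ← Matrix.mul_assoc]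
    simp [Finset.sum_add_distrib, add_assoc]
  · have hc : ∀ i, ((∑ j ∈ F, v i j : NNReal) : ℝ)
        = ∑ j ∈ Finset.range t, σw ^ 2 * ∑ k, (s.C * s.A ^ (t - 1 - j)) i k ^ 2
        + (∑ j ∈ Finset.range t, σu ^ 2 * ∑ k, (s.C * s.A ^ (t - 1 - j) * s.B) i k ^ 2 + ση ^ 2) := by
      intro i
      have h1 : ∑ k, (1 : Matrix (Fin dy) (Fin dy) ℝ) i k ^ 2 = 1 := by
        simp [Matrix.one_apply, ite_pow]
      simp only [F, Finset.sum_disjSum, v, Sum.elim_inl, Sum.elim_inr, Finset.sum_singleton, h1,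
        NNReal.coe_add, NNReal.coe_sum]
      rw [Real.coe_toNNReal _ (by positivity), mul_one]
      congr 1
      · exact Finset.sum_congr rfl fun j _ => Real.coe_toNNReal _ (by positivity)
      · congr 1
        exact Finset.sum_congr rfl fun j _ => Real.coe_toNNReal _ (by positivity)
    simp only [hc, Finset.sum_add_distrib, Finset.sum_const, Finset.card_univ, Fintype.card_fin,
      nsmul_eq_mul]
    have hw := hP.sum_sq_entries_le hs (1 : Matrix (Fin dx) (Fin dx) ℝ) t
    have hu := hP.sum_sq_entries_le hs s.B t
    simp only [Matrix.mul_one, Matrix.transpose_one, Matrix.one_mul] at hw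
    -- Reversing the summation index matches the Gramian powers with the exponents `t - 1 - j` of
    -- the convolution.
    rw [← Finset.sum_range_reflect] at hw hu
    have e1 : ∑ i, ∑ j ∈ Finset.range t, σw ^ 2 * ∑ k, (s.C * s.A ^ (t - 1 - j)) i k ^ 2
        = σw ^ 2 * ∑ j ∈ Finset.range t, ∑ i, ∑ k, (s.C * s.A ^ (t - 1 - j)) i k ^ 2 := by
      rw [Finset.sum_comm]; simp only [Finset.mul_sum]
    have e2 : ∑ i, ∑ j ∈ Finset.range t, σu ^ 2 * ∑ k, (s.C * s.A ^ (t - 1 - j) * s.B) i k ^ 2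
        = σu ^ 2 * ∑ j ∈ Finset.range t, ∑ i, ∑ k, (s.C * s.A ^ (t - 1 - j) * s.B) i k ^ 2 := by
      rw [Finset.sum_comm]; simp only [Finset.mul_sum]
    rw [e1, e2]
    have := mul_le_mul_of_nonneg_left hw (sq_nonneg σw)
    have := mul_le_mul_of_nonneg_left hu (sq_nonneg σu)
    linarith

end Noise

/-! ### Covering argument and maximal inequality -/

-- Greedy scan from the left. A bad start opens a block of length `τ` whose sum pays `a` for each of
-- its at most `τ` bad starts, and the scan resumes after the block; a good start is skipped. The
-- blocks are disjoint and overrun `K` by at most `N`.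
open Classical in
theorem sum_Ico_ite_le_sum {g : ℕ → ℝ} (hg : ∀ t, 0 ≤ g t) {a : ℝ} (ha : 0 ≤ a) {N K : ℕ}
    {bad : ℕ → Prop}
    (hbad : ∀ k, bad k → ∃ τ, 0 < τ ∧ τ ≤ N ∧ a * τ ≤ ∑ t ∈ Finset.range τ, g (k + t)) :
    ∀ n k₀, k₀ ≤ K → K - k₀ = n →
      ∑ k ∈ Finset.Ico k₀ K, (if bad k then a else 0) ≤ ∑ t ∈ Finset.Ico k₀ (K + N), g t := by
  intro n
  induction n using Nat.strong_induction_on with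
  | _ n ih =>
    intro k₀ hk hn
    rcases hk.eq_or_lt with rfl | hlt
    · simpa using Finset.sum_nonneg fun t _ => hg t
    by_cases hb : bad k₀
    · obtain ⟨τ, hτ0, hτN, hτ⟩ := hbad k₀ hb
      have hblock : ∑ t ∈ Finset.Ico k₀ (k₀ + τ), g t = ∑ t ∈ Finset.range τ, g (k₀ + t) := by
        rw [Finset.sum_Ico_eq_sum_range, add_tsub_cancel_left]
      have hcount : ∀ l, l ≤ k₀ + τ →
          ∑ k ∈ Finset.Ico k₀ l, (if bad k then a else 0) ≤ a * τ := by
        intro l hl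
        calc ∑ k ∈ Finset.Ico k₀ l, (if bad k then a else 0) ≤ ∑ k ∈ Finset.Ico k₀ l, a :=
              Finset.sum_le_sum fun k _ => by split_ifs <;> linarith
          _ = ((l - k₀ : ℕ) : ℝ) * a := by simp
          _ ≤ τ * a := by
              refine mul_le_mul_of_nonneg_right ?_ ha
              have : l - k₀ ≤ τ := by omega
              exact_mod_cast this
          _ = a * τ := mul_comm _ _
      rcases le_or_gt K (k₀ + τ) with hK | hK
      · have h1 := hcount K hK
        have h2 : ∑ t ∈ Finset.Ico k₀ (k₀ + τ), g t ≤ ∑ t ∈ Finset.Ico k₀ (K + N), g t :=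
          Finset.sum_le_sum_of_subset_of_nonneg (Finset.Ico_subset_Ico_right (by omega))
            fun t _ _ => hg t
        linarith
      · have h1 := hcount (k₀ + τ) le_rfl
        have h2 := ih (K - (k₀ + τ)) (by omega) (k₀ + τ) hK.le rfl
        rw [← Finset.sum_Ico_consecutive _ (show k₀ ≤ k₀ + τ by omega) hK.le,
          ← Finset.sum_Ico_consecutive _ (show k₀ ≤ k₀ + τ by omega)
            (show k₀ + τ ≤ K + N by omega)]
        linarith
    · have h2 := ih (K - (k₀ + 1)) (by omega) (k₀ + 1) hlt rfl
      rw [Finset.sum_eq_sum_Ico_succ_bot hlt, Finset.sum_eq_sum_Ico_succ_bot (show k₀ < K + N by omega)]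
      have := hg k₀
      simp only [hb, if_false]
      linarith

/-- A maximal inequality for a (not necessarily stationary) nonnegative process, averaged over the
starting time. -/
theorem sum_measureReal_le_of_exists_average {Ω : Type*} [MeasurableSpace Ω] {μ : Measure Ω}
    [IsProbabilityMeasure μ] {g : ℕ → Ω → ℝ} (hg : ∀ t ω, 0 ≤ g t ω) {c : ℝ}
    (hgi : ∀ t, Integrable (g t) μ) (hgc : ∀ t, ∫ ω, g t ω ∂μ ≤ c) {a : ℝ} (ha : 0 ≤ a) {N : ℕ}
    {F : ℕ → Set Ω} (hFm : ∀ k, MeasurableSet (F k))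
    (hF : ∀ k, ∀ ω ∈ F k, ∃ τ, 0 < τ ∧ τ ≤ N ∧ a * τ ≤ ∑ t ∈ Finset.range τ, g (k + t) ω) (K : ℕ) :
    ∑ k ∈ Finset.range K, a * μ.real (F k) ≤ (K + N) * c := by
  classical
  have hpt : ∀ ω, ∑ k ∈ Finset.range K, (F k).indicator (fun _ => a) ω
      ≤ ∑ t ∈ Finset.range (K + N), g t ω := by
    intro ω
    have := sum_Ico_ite_le_sum (g := fun t => g t ω) (fun t => hg t ω) ha (N := N) (K := K)
      (bad := fun k => ω ∈ F k) (fun k hk => hF k ω hk) K 0 (Nat.zero_le _) (Nat.sub_zero _)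
    simpa only [Set.indicator_apply, Finset.range_eq_Ico] using this
  have hi : ∀ k ∈ Finset.range K, Integrable ((F k).indicator fun _ => a) μ :=
    fun k _ => (integrable_const a).indicator (hFm k)
  have h := integral_mono (integrable_finsetSum _ hi)
    (integrable_finsetSum (Finset.range (K + N)) fun t _ => hgi t) hpt
  rw [integral_finsetSum _ hi, integral_finsetSum _ fun t _ => hgi t] at h
  calc ∑ k ∈ Finset.range K, a * μ.real (F k)
      = ∑ k ∈ Finset.range K, ∫ ω, (F k).indicator (fun _ => a) ω ∂μ :=
        Finset.sum_congr rfl fun k _ => by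
          rw [integral_indicator_const _ (hFm k), smul_eq_mul, mul_comm]
    _ ≤ ∑ t ∈ Finset.range (K + N), ∫ ω, g t ω ∂μ := h
    _ ≤ ∑ t ∈ Finset.range (K + N), c := Finset.sum_le_sum fun t _ => hgc t
    _ = (K + N) * c := by simp

/-- The margin that the tail bound needs: `exp (L/2) - exp (-L)` increases in `L` and is already
large enough at `L = 1`. -/
theorem exp_three_halves_mul_sub_one_ge {L : ℝ} (hL : 1 ≤ L) :
    1.176 ≤ Real.exp (-L) * (Real.exp (3 / 2 * L) - 1) := by
  have h1 : Real.exp (-L) * (Real.exp (3 / 2 * L) - 1) = Real.exp (L / 2) - Real.exp (-L) := by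
    rw [mul_sub, ← Real.exp_add]
    ring_nf
  have h2 : Real.exp (1 / 2) ≤ Real.exp (L / 2) := Real.exp_le_exp.2 (by linarith)
  have h3 : Real.exp (-L) ≤ Real.exp (-1) := Real.exp_le_exp.2 (by linarith)
  have h4 := Real.exp_neg_one_lt_d9
  have h5 := Real.quadratic_le_exp_of_nonneg (show (0 : ℝ) ≤ 1 / 2 by norm_num)
  rw [h1]
  norm_num at h5 h4 ⊢
  linarith

/-! ### Tail bound for the zero-start energy, uniform in time -/

section Tail

variable {Ω : Type*} [MeasurableSpace Ω] {μ : Measure Ω} {dx du dy : ℕ} {σw σu ση : ℝ}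
  {w : ℕ → Ω → EuclideanSpace ℝ (Fin dx)}
  {u : ℕ → Ω → EuclideanSpace ℝ (Fin du)} {η : ℕ → Ω → EuclideanSpace ℝ (Fin dy)}

theorem measurableSet_exists_lt_sum_sq_norm (n : ℕ) (a : ℝ) (p : ℕ → Prop) :
    MeasurableSet {y : ℕ → EuclideanSpace ℝ (Fin n) |
      ∃ τ, p τ ∧ a * τ < ∑ t ∈ Finset.range τ, ‖y t‖ ^ 2} := by
  have : {y : ℕ → EuclideanSpace ℝ (Fin n) |
      ∃ τ, p τ ∧ a * τ < ∑ t ∈ Finset.range τ, ‖y t‖ ^ 2}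
      = ⋃ τ ∈ {τ | p τ}, {y | a * τ < ∑ t ∈ Finset.range τ, ‖y t‖ ^ 2} := by
    ext y; simp
  rw [this]
  exact MeasurableSet.biUnion (Set.to_countable _) fun τ _ =>
    measurableSet_lt measurable_const (by fun_prop)

/-- With `q` the probability to bound and `a = exp (3L/2) - 1`, symmetrization gives `q ≤ 2 μ(F k)`
for every starting time `k`; averaging over `k` and the maximal inequality then bound `a q`. -/
theorem IsGaussianNoise.measure_exists_lt_energy_le_of_bounded [IsProbabilityMeasure μ]
    (h : IsGaussianNoise μ σw σu ση w u η) {s : LinSys dx du dy} (hs : s.Stable)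
    {P : Matrix (Fin dx) (Fin dx) ℝ} (hP : s.IsLyapunovSolution P) {m : ℝ}
    (hm : σw ^ 2 * P.trace + σu ^ 2 * (s.Bᵀ * P * s.B).trace + ση ^ 2 * dy < m)
    {L : ℝ} (hL : 1 ≤ L) (N : ℕ) :
    μ {ω | ∃ τ, (0 < τ ∧ τ ≤ N) ∧
      5 * m * L * τ < ∑ t ∈ Finset.range τ, ‖s.output 0 w u η t ω‖ ^ 2}
      ≤ ENNReal.ofReal (Real.exp (-L)) := by
  have hv0 : 0 ≤ σw ^ 2 * P.trace + σu ^ 2 * (s.Bᵀ * P * s.B).trace + ση ^ 2 * dy := by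
    obtain ⟨v, -, hv⟩ := h.exists_hasLaw_output hs hP 0
    exact (Finset.sum_nonneg fun i _ => (v i).coe_nonneg).trans hv
  have hm0 : 0 < m := hv0.trans_lt hm
  rcases Nat.eq_zero_or_pos N with rfl | hN
  · have : {ω | ∃ τ, (0 < τ ∧ τ ≤ 0) ∧
      5 * m * L * τ < ∑ t ∈ Finset.range τ, ‖s.output 0 w u η t ω‖ ^ 2} = ∅ := by
      ext ω
      simp only [Set.mem_ofPred_eq, Set.mem_empty_iff_false, iff_false]
      rintro ⟨τ, ⟨h1, h2⟩, -⟩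
      omega
    rw [this]; simp
  set T : Set (ℕ → EuclideanSpace ℝ (Fin dy)) := {y | ∃ τ, (0 < τ ∧ τ ≤ N) ∧
      5 * m * L * τ < ∑ t ∈ Finset.range τ, ‖y t‖ ^ 2} with hT
  have hTm : MeasurableSet T := measurableSet_exists_lt_sum_sq_norm dy _ _
  let Tk : ℕ → Set (ℕ → EuclideanSpace ℝ (Fin dy)) := fun k => {y | (fun t => y (k + t)) ∈ T}
  have hTkm : ∀ k, MeasurableSet (Tk k) := fun k =>
    hTm.preimage (f := fun (y : ℕ → EuclideanSpace ℝ (Fin dy)) t => y (k + t)) (by fun_prop)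
  let F : ℕ → Set Ω := fun k => {ω | (fun t => s.output 0 w u η t ω) ∈ Tk k}
  have hym : ∀ t, Measurable (s.output 0 w u η t) :=
    s.measurable_output 0 w u η measurable_const h.measurable_w h.measurable_u h.measurable_η
  have hFm : ∀ k, MeasurableSet (F k) := fun k =>
    (hTkm k).preimage (measurable_pi_lambda _ hym)
  -- If the restarted window exceeds the level, so does the window of the output or of its
  -- sign-flipped copy, since the restarted output is their average and the squared norm is convex.
  have hq : ∀ k, μ.real {ω | (fun t => s.output 0 w u η t ω) ∈ T} ≤ 2 * μ.real (F k) := by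
    intro k
    have e1 := h.measure_output_eq (h.shift k) s hTm
    have e2 := h.measure_output_eq (h.negBefore k) s (hTkm k)
    have hsub : {ω | (fun t => s.output 0 (fun j => w (k + j)) (fun j => u (k + j))
        (fun j => η (k + j)) t ω) ∈ T} ⊆ F k ∪ {ω | (fun t => s.output 0 (LinSys.negBefore k w)
          (LinSys.negBefore k u) (LinSys.negBefore k η) t ω) ∈ Tk k} := by
      rintro ω ⟨τ, hτ, hlt⟩
      by_contra hcon
      rw [Set.mem_union, not_or] at hcon
      have h1 : ∑ t ∈ Finset.range τ, ‖s.output 0 w u η (k + t) ω‖ ^ 2 ≤ 5 * m * L * τ := by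
        by_contra h1
        exact hcon.1 ⟨τ, hτ, not_le.1 h1⟩
      have h2 : ∑ t ∈ Finset.range τ, ‖s.output 0 (LinSys.negBefore k w)
          (LinSys.negBefore k u) (LinSys.negBefore k η) (k + t) ω‖ ^ 2 ≤ 5 * m * L * τ := by
        by_contra h2
        exact hcon.2 ⟨τ, hτ, not_le.1 h2⟩
      have h3 : ∀ t, 2 * ‖s.output 0 (fun j => w (k + j)) (fun j => u (k + j))
          (fun j => η (k + j)) t ω‖ ^ 2 ≤ ‖s.output 0 w u η (k + t) ω‖ ^ 2
          + ‖s.output 0 (LinSys.negBefore k w)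
          (LinSys.negBefore k u) (LinSys.negBefore k η) (k + t) ω‖ ^ 2 := by
        intro t
        have h4 := congrArg norm (s.output_shift_eq_average w u η k t ω)
        rw [norm_smul, Real.norm_eq_abs, abs_two] at h4
        have h5 := norm_add_le (s.output 0 w u η (k + t) ω) (s.output 0 (LinSys.negBefore k w)
          (LinSys.negBefore k u) (LinSys.negBefore k η) (k + t) ω)
        rw [← h4] at h5
        have h6 := pow_le_pow_left₀ (by positivity) h5 2
        have h7 := add_sq_le (a := ‖s.output 0 w u η (k + t) ω‖) (b := ‖s.output 0
          (LinSys.negBefore k w) (LinSys.negBefore k u) (LinSys.negBefore k η) (k + t) ω‖)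
        linarith
      have h4 := Finset.sum_le_sum fun t (_ : t ∈ Finset.range τ) => h3 t
      rw [← Finset.mul_sum, Finset.sum_add_distrib] at h4
      linarith
    have e3 : μ {ω | (fun t => s.output 0 w u η t ω) ∈ T} ≤ μ (F k) + μ (F k) := by
      rw [e1]
      refine (measure_mono hsub).trans ((measure_union_le _ _).trans ?_)
      rw [← e2]
    rw [two_mul]
    have := ENNReal.toReal_mono (by finiteness) e3
    rwa [ENNReal.toReal_add (by finiteness) (by finiteness)] at this
  let g : ℕ → Ω → ℝ := fun t ω => Real.exp (3 / 10 * (‖s.output 0 w u η t ω‖ ^ 2 / m)) - 1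
  have hg0 : ∀ t ω, 0 ≤ g t ω := by
    intro t ω
    have := Real.one_le_exp (show 0 ≤ 3 / 10 * (‖s.output 0 w u η t ω‖ ^ 2 / m) by positivity)
    simp only [g]
    linarith
  have hg : ∀ t, Integrable (g t) μ ∧ ∫ ω, g t ω ∂μ ≤ 0.582 := by
    intro t
    obtain ⟨v, hvl, hv⟩ := h.exists_hasLaw_output hs hP t
    exact integral_exp_norm_sq_sub_one_le (hym t) hvl (hv.trans_lt hm)
  set a : ℝ := Real.exp (3 / 2 * L) - 1 with ha
  have ha0 : 0 < a := by
    have := Real.one_lt_exp_iff.2 (show 0 < 3 / 2 * L by linarith)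
    linarith
  have hF : ∀ k, ∀ ω ∈ F k,
      ∃ τ, 0 < τ ∧ τ ≤ N ∧ a * τ ≤ ∑ t ∈ Finset.range τ, g (k + t) ω := by
    rintro k ω ⟨τ, ⟨hτ0, hτN⟩, hlt⟩
    refine ⟨τ, hτ0, hτN, ?_⟩
    -- Jensen in tangent form: the tangent to `exp` at `3/2 * L`, which is `3/10` of the level `5
    -- L`.
    have htan : ∀ t, Real.exp (3 / 2 * L) *
        (3 / 10 * (‖s.output 0 w u η (k + t) ω‖ ^ 2 / m) - 3 / 2 * L) + a ≤ g (k + t) ω := by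
      intro t
      have h1 := Real.add_one_le_exp
        (3 / 10 * (‖s.output 0 w u η (k + t) ω‖ ^ 2 / m) - 3 / 2 * L)
      have h2 := mul_le_mul_of_nonneg_left h1 (Real.exp_pos (3 / 2 * L)).le
      rw [← Real.exp_add, add_sub_cancel] at h2
      simp only [g, ha]
      linarith
    have hsum := Finset.sum_le_sum fun t (_ : t ∈ Finset.range τ) => htan t
    rw [Finset.sum_add_distrib, ← Finset.mul_sum, Finset.sum_sub_distrib, ← Finset.mul_sum,
      ← Finset.sum_div] at hsum
    simp only [Finset.sum_const, Finset.card_range, nsmul_eq_mul] at hsum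
    have hge : 5 * L * τ ≤ (∑ t ∈ Finset.range τ, ‖s.output 0 w u η (k + t) ω‖ ^ 2) / m := by
      rw [le_div_iff₀ hm0]
      calc 5 * L * τ * m = 5 * m * L * τ := by ring
        _ ≤ _ := hlt.le
    have hpos : 0 ≤ Real.exp (3 / 2 * L) * (3 / 10 * ((∑ t ∈ Finset.range τ,
        ‖s.output 0 w u η (k + t) ω‖ ^ 2) / m) - τ * (3 / 2 * L)) := by
      refine mul_nonneg (Real.exp_pos _).le ?_
      linarith
    linarith
  -- With `100 N` starting times the overrun `N` costs one percent: `2 · 1.01 · 0.582 = 1.17564 ≤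
  -- 1.176`.
  have hmax := sum_measureReal_le_of_exists_average hg0 (fun t => (hg t).1) (fun t => (hg t).2)
    ha0.le hFm hF (100 * N)
  set q := μ.real {ω | (fun t => s.output 0 w u η t ω) ∈ T} with hqdef
  have hlow : ((100 * N : ℕ) : ℝ) * (a * q) ≤ 2 * ((((100 * N : ℕ) : ℝ) + N) * 0.582) := by
    have h1 : ∑ k ∈ Finset.range (100 * N), a * q
        ≤ ∑ k ∈ Finset.range (100 * N), 2 * (a * μ.real (F k)) :=
      Finset.sum_le_sum fun k _ => by nlinarith [hq k]
    have h2 : ∑ k ∈ Finset.range (100 * N), a * q = ((100 * N : ℕ) : ℝ) * (a * q) := by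
      rw [Finset.sum_const, Finset.card_range, nsmul_eq_mul]
    rw [h2, ← Finset.mul_sum] at h1
    linarith
  have hN' : (0 : ℝ) < N := by exact_mod_cast hN
  have haq : a * q ≤ 1.176 := by
    push_cast at hlow
    have : (N : ℝ) * (100 * (a * q)) ≤ N * 117.564 := by linarith
    have := le_of_mul_le_mul_left this hN'
    linarith
  have hqL : q ≤ Real.exp (-L) := by
    have h1 := exp_three_halves_mul_sub_one_ge hL
    rw [← ha] at h1
    have : a * q ≤ a * Real.exp (-L) := by linarith
    exact le_of_mul_le_mul_left this ha0
  rw [hqdef, Measure.real, ← ENNReal.le_ofReal_iff_toReal_le (by finiteness) (Real.exp_pos _).le]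
    at hqL
  exact hqL

/-- The horizon bound and the slack in `m` are removed together along the increasing events `E n`;
the strict inequality in the event survives a small enough slack. -/
theorem IsGaussianNoise.measure_exists_lt_energy_le [IsProbabilityMeasure μ]
    (h : IsGaussianNoise μ σw σu ση w u η) {s : LinSys dx du dy} (hs : s.Stable)
    {P : Matrix (Fin dx) (Fin dx) ℝ} (hP : s.IsLyapunovSolution P) {m : ℝ}
    (hm : σw ^ 2 * P.trace + σu ^ 2 * (s.Bᵀ * P * s.B).trace + ση ^ 2 * dy ≤ m)
    {L : ℝ} (hL : 1 ≤ L) :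
    μ {ω | ∃ τ, 0 < τ ∧
      5 * m * L * τ < ∑ t ∈ Finset.range τ, ‖s.output 0 w u η t ω‖ ^ 2}
      ≤ ENNReal.ofReal (Real.exp (-L)) := by
  let E : ℕ → Set Ω := fun n => {ω | ∃ τ, (0 < τ ∧ τ ≤ n) ∧
      5 * (m + 1 / ((n : ℝ) + 1)) * L * τ < ∑ t ∈ Finset.range τ, ‖s.output 0 w u η t ω‖ ^ 2}
  have hE : ∀ n, μ (E n) ≤ ENNReal.ofReal (Real.exp (-L)) := fun n =>
    h.measure_exists_lt_energy_le_of_bounded hs hP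
      (lt_add_of_le_of_pos hm (by positivity)) hL n
  have hmono : Monotone E := by
    rintro n n' hn ω ⟨τ, ⟨h1, h2⟩, h3⟩
    refine ⟨τ, ⟨h1, h2.trans hn⟩, lt_of_le_of_lt ?_ h3⟩
    have := one_div_le_one_div_of_le (by positivity : (0 : ℝ) < n + 1)
      (by have : (n : ℝ) ≤ n' := by exact_mod_cast hn
          linarith : (n : ℝ) + 1 ≤ n' + 1)
    have hL0 : 0 ≤ L := by linarith
    gcongr
  refine (measure_mono ?_).trans
    (le_of_tendsto' (tendsto_measure_iUnion_atTop (μ := μ) hmono) hE)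
  rintro ω ⟨τ, hτ, hlt⟩
  have hlim : Tendsto (fun n : ℕ => 5 * (m + 1 / ((n : ℝ) + 1)) * L * τ) atTop
      (𝓝 (5 * (m + 0) * L * τ)) :=
    (((tendsto_one_div_add_atTop_nhds_zero_nat.const_add m).const_mul 5).mul_const L).mul_const _
  rw [add_zero] at hlim
  obtain ⟨n, hn1, hn2⟩ := ((hlim.eventually_lt_const hlt).and (eventually_ge_atTop τ)).exists
  exact Set.mem_iUnion.2 ⟨n, τ, ⟨hτ, hn2⟩, hn1⟩

end Tail

/-- The σ-algebras generated by the initial state and by the individual noise vectors. -/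
abbrev modelSigma {Ω : Type*} {dx du dy : ℕ} (x₁ : Ω → EuclideanSpace ℝ (Fin dx))
    (w : ℕ → Ω → EuclideanSpace ℝ (Fin dx))
    (u : ℕ → Ω → EuclideanSpace ℝ (Fin du)) (η : ℕ → Ω → EuclideanSpace ℝ (Fin dy)) :
    Unit ⊕ ℕ ⊕ ℕ ⊕ ℕ → MeasurableSpace Ω :=
  Sum.elim (fun _ : Unit => MeasurableSpace.comap x₁ inferInstance) (noiseSigma w u η)

theorem measurable_iSup_modelSigma {Ω : Type*} {dx du dy : ℕ}
    {x₁ : Ω → EuclideanSpace ℝ (Fin dx)} {w : ℕ → Ω → EuclideanSpace ℝ (Fin dx)}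
    {u : ℕ → Ω → EuclideanSpace ℝ (Fin du)} {η : ℕ → Ω → EuclideanSpace ℝ (Fin dy)}
    {S : Set (Unit ⊕ ℕ ⊕ ℕ ⊕ ℕ)} {β : Type*} [MeasurableSpace β]
    {f : Ω → β} (i : Unit ⊕ ℕ ⊕ ℕ ⊕ ℕ) (hi : i ∈ S) (hf : Measurable[modelSigma x₁ w u η i] f) :
    Measurable[⨆ j ∈ S, modelSigma x₁ w u η j] f :=
  hf.mono (le_iSup₂_of_le i hi le_rfl) le_rfl

/-- Isolates the first process noise; the remaining term no longer depends on it. -/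
theorem LinSys.state_succ_eq_add_first {Ω : Type*} {dx du dy : ℕ}
    {x₁ : Ω → EuclideanSpace ℝ (Fin dx)} {w : ℕ → Ω → EuclideanSpace ℝ (Fin dx)}
    {u : ℕ → Ω → EuclideanSpace ℝ (Fin du)}
    (s : LinSys dx du dy) (k : ℕ) (ω : Ω) :
    s.state x₁ w u (k + 1) ω = s.state x₁ (Function.update w 0 0) u (k + 1) ω
      + Matrix.toEuclideanLin (s.A ^ k) (w 0 ω) := by
  induction k with
  | zero => simp [LinSys.state]
  | succ k ih =>
    rw [LinSys.state, ih, map_add, LinSys.toEuclideanLin_pow_succ_apply]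
    conv_rhs => rw [LinSys.state]
    rw [Function.update_of_ne (Nat.succ_ne_zero k)]
    abel

/-! ### Independence of the sources, the stable case, anti-concentration -/

section Model

variable {Ω : Type*} [mΩ : MeasurableSpace Ω] {μ : Measure Ω} {dx du dy : ℕ} {σw σu ση : ℝ}
  {x₁ : Ω → EuclideanSpace ℝ (Fin dx)} {w : ℕ → Ω → EuclideanSpace ℝ (Fin dx)}
  {u : ℕ → Ω → EuclideanSpace ℝ (Fin du)} {η : ℕ → Ω → EuclideanSpace ℝ (Fin dy)}

theorem IsNoiseModel.modelSigma_le (h : IsNoiseModel μ σw σu ση x₁ w u η)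
    (i : Unit ⊕ ℕ ⊕ ℕ ⊕ ℕ) : modelSigma x₁ w u η i ≤ mΩ := by
  rcases i with i | i | i | i
  · exact h.measurable_x₁.comap_le
  · exact (h.measurable_w i).comap_le
  · exact (h.measurable_u i).comap_le
  · exact (h.measurable_η i).comap_le

/-- One of the independent sources and any function of the others are independent. -/
theorem IsNoiseModel.indepFun_of_measurable (h : IsNoiseModel μ σw σu ση x₁ w u η)
    (i : Unit ⊕ ℕ ⊕ ℕ ⊕ ℕ) {β γ : Type*} [MeasurableSpace β] [MeasurableSpace γ]
    {f : Ω → β} {g : Ω → γ} (hf : Measurable[modelSigma x₁ w u η i] f)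
    (hg : Measurable[⨆ j ∈ ({i}ᶜ : Set _), modelSigma x₁ w u η j] g) : IndepFun f g μ := by
  rw [IndepFun_iff_Indep]
  have hi := indep_iSup_of_disjoint h.modelSigma_le h.indep
    (disjoint_compl_right (a := ({i} : Set (Unit ⊕ ℕ ⊕ ℕ ⊕ ℕ))))
  refine indep_of_indep_of_le_left (indep_of_indep_of_le_right hi hg.comap_le) ?_
  refine hf.comap_le.trans ?_
  exact le_iSup₂_of_le i (Set.mem_singleton i) le_rfl

theorem measurableSet_transientBound (S : Set (LinSys dx du dy)) (M : ℝ) :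
    MeasurableSet {v | TransientBound S M v} := by
  -- The intersection over all matrices `P` is uncountable, so measurability goes through
  -- closedness.
  apply IsClosed.measurableSet
  have : {v | TransientBound S M v} = ⋂ s ∈ S, ⋂ (_ : s.Stable), ⋂ P,
      ⋂ (_ : s.IsLyapunovSolution P), {v | inner ℝ v (Matrix.toEuclideanLin P v) ≤ M} := by
    ext v
    simp [TransientBound]
  rw [this]
  refine isClosed_biInter fun s _ => isClosed_iInter fun _ => isClosed_iInter fun P =>
    isClosed_iInter fun _ => isClosed_le ?_ continuous_const
  have h1 : Continuous (Matrix.toEuclideanLin P) := LinearMap.continuous_of_finiteDimensional _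
  fun_prop

/-- By uniqueness of the Lyapunov solution each stable member contributes a single value, so the set
is finite. -/
theorem bddAbove_threshold {S : Set (LinSys dx du dy)} (hS : S.Finite) (σw σu ση M : ℝ) (τ : ℕ)
    (δ : ℝ) :
    BddAbove {r : ℝ | ∃ s ∈ S, s.Stable ∧ ∃ P, s.IsLyapunovSolution P ∧
      r = 2 * M + 10 * (τ : ℝ) * (σw ^ 2 * P.trace + σu ^ 2 * (s.Bᵀ * P * s.B).trace
      + ση ^ 2 * (max dx dy : ℕ)) * Real.log (1 / δ)} := by
  refine Set.Finite.bddAbove ((hS.biUnion (t := fun s => {r : ℝ | s.Stable ∧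
    ∃ P, s.IsLyapunovSolution P ∧
      r = 2 * M + 10 * (τ : ℝ) * (σw ^ 2 * P.trace + σu ^ 2 * (s.Bᵀ * P * s.B).trace
      + ση ^ 2 * (max dx dy : ℕ)) * Real.log (1 / δ)}) fun s _ => ?_).subset ?_)
  · refine Set.Subsingleton.finite ?_
    rintro r ⟨hs, P, hP, rfl⟩ r' ⟨-, P', hP', rfl⟩
    rw [hP.unique hP' hs]
  · rintro r ⟨s, hs, h⟩
    exact Set.mem_biUnion hs h

theorem IsNoiseModel.stable_energy_bound [IsProbabilityMeasure μ]
    (h : IsNoiseModel μ σw σu ση x₁ w u η) {S : Set (LinSys dx du dy)} (hS : S.Finite)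
    {s : LinSys dx du dy} (hsS : s ∈ S) (hs : s.Stable) (M : ℝ) {δ : ℝ} (hδ : 0 < δ)
    (hδ1 : δ < Real.exp (-1)) :
    (1 - δ) * μ.real {ω | TransientBound S M (x₁ ω)} ≤
      μ.real {ω | TransientBound S M (x₁ ω) ∧
        ∀ τ : ℕ, 0 < τ → s.outputEnergy x₁ w u η τ ω ≤ threshold S σw σu ση M τ δ} := by
  obtain ⟨P, hP⟩ := hs.exists_isLyapunovSolution
  set m : ℝ := σw ^ 2 * P.trace + σu ^ 2 * (s.Bᵀ * P * s.B).trace + ση ^ 2 * (max dx dy : ℕ)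
    with hm
  set L : ℝ := Real.log (1 / δ) with hL
  have hLδ : Real.exp (-L) = δ := by
    rw [hL, one_div, Real.log_inv, neg_neg, Real.exp_log hδ]
  have hL1 : 1 ≤ L := by
    rw [← hLδ, Real.exp_lt_exp] at hδ1
    linarith
  have hbad := h.isGaussianNoise.measure_exists_lt_energy_le hs hP (m := m) (by
    rw [hm]
    have : (dy : ℝ) ≤ (max dx dy : ℕ) := by exact_mod_cast le_max_right _ _
    gcongr) hL1
  rw [hLδ] at hbad
  set T : Set (ℕ → EuclideanSpace ℝ (Fin dy)) :=
    {y | ∃ τ, 0 < τ ∧ 5 * m * L * τ < ∑ t ∈ Finset.range τ, ‖y t‖ ^ 2} with hT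
  have hTm : MeasurableSet T := measurableSet_exists_lt_sum_sq_norm dy _ _
  let Y : Ω → ℕ → EuclideanSpace ℝ (Fin dy) := fun ω t => s.output 0 w u η t ω
  have hind : IndepFun x₁ Y μ := by
    refine h.indepFun_of_measurable (Sum.inl ()) (comap_measurable x₁) ?_
    refine @measurable_pi_lambda _ _ _ (⨆ j ∈ _, modelSigma x₁ w u η j) _ _ fun t => ?_
    refine @LinSys.measurable_output dx du dy Ω s 0 w u η
      (⨆ j ∈ _, modelSigma x₁ w u η j) measurable_const ?_ ?_ ?_ t
    · exact fun j => measurable_iSup_modelSigma (Sum.inr (Sum.inl j)) (by simp)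
        (comap_measurable _)
    · exact fun j => measurable_iSup_modelSigma (Sum.inr (Sum.inr (Sum.inl j))) (by simp)
        (comap_measurable _)
    · exact fun j => measurable_iSup_modelSigma (Sum.inr (Sum.inr (Sum.inr j))) (by simp)
        (comap_measurable _)
  have hYm : Measurable Y := measurable_pi_lambda _ (s.measurable_output 0 w u η measurable_const
    h.measurable_w h.measurable_u h.measurable_η)
  have hmul := hind.measure_inter_preimage_eq_mul _ _ (measurableSet_transientBound S M) hTm.compl
  have hreal : μ.real (x₁ ⁻¹' {v | TransientBound S M v} ∩ Y ⁻¹' Tᶜ)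
      = μ.real (x₁ ⁻¹' {v | TransientBound S M v}) * μ.real (Y ⁻¹' Tᶜ) := by
    simp only [Measure.real, hmul, ENNReal.toReal_mul]
  have hcompl : 1 - δ ≤ μ.real (Y ⁻¹' Tᶜ) := by
    rw [Set.preimage_compl, probReal_compl_eq_one_sub (hYm hTm)]
    have : μ.real (Y ⁻¹' T) ≤ δ := ENNReal.toReal_le_of_le_ofReal hδ.le hbad
    linarith
  calc (1 - δ) * μ.real {ω | TransientBound S M (x₁ ω)}
      ≤ μ.real (Y ⁻¹' Tᶜ) * μ.real (x₁ ⁻¹' {v | TransientBound S M v}) :=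
        mul_le_mul_of_nonneg_right hcompl measureReal_nonneg
    _ = μ.real (x₁ ⁻¹' {v | TransientBound S M v} ∩ Y ⁻¹' Tᶜ) := by rw [hreal, mul_comm]
    _ ≤ _ := by
        refine measureReal_mono ?_
        rintro ω ⟨h1, h2⟩
        refine ⟨h1, fun τ hτ => ?_⟩
        have hx : inner ℝ (x₁ ω) (Matrix.toEuclideanLin P (x₁ ω)) ≤ M := h1 s hsS hs P hP
        have hx' := (hP.sum_sq_norm_le hs (x₁ ω) τ).trans hx
        have hy : ∑ t ∈ Finset.range τ, ‖s.output 0 w u η t ω‖ ^ 2 ≤ 5 * m * L * τ := by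
          by_contra hcon
          exact h2 ⟨τ, hτ, not_le.1 hcon⟩
        -- The factor two from `‖a + b‖² ≤ 2‖a‖² + 2‖b‖²` turns `M` into `2 M` and `5` into `10`.
        have hE : s.outputEnergy x₁ w u η τ ω ≤ 2 * M + 10 * τ * m * L := by
          have : s.outputEnergy x₁ w u η τ ω ≤ ∑ t ∈ Finset.range τ,
              (2 * ‖Matrix.toEuclideanLin (s.C * s.A ^ t) (x₁ ω)‖ ^ 2
                + 2 * ‖s.output 0 w u η t ω‖ ^ 2) := by
            refine Finset.sum_le_sum fun t _ => ?_
            rw [LinSys.output_eq_pow_add]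
            have h3 := pow_le_pow_left₀ (norm_nonneg _)
              (norm_add_le (Matrix.toEuclideanLin (s.C * s.A ^ t) (x₁ ω)) (s.output 0 w u η t ω)) 2
            have h4 := add_sq_le (a := ‖Matrix.toEuclideanLin (s.C * s.A ^ t) (x₁ ω)‖)
              (b := ‖s.output 0 w u η t ω‖)
            linarith
          rw [Finset.sum_add_distrib, ← Finset.mul_sum, ← Finset.mul_sum] at this
          linarith
        exact hE.trans (le_csSup (bddAbove_threshold hS σw σu ση M τ δ)
          ⟨s, hsS, hs, P, hP, rfl⟩)

/-- Anti-concentration of the output in terms of the gain of `C Aᵏ` in some direction. -/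
theorem IsNoiseModel.measure_sq_norm_output_lt_le [IsProbabilityMeasure μ]
    (h : IsNoiseModel μ σw σu ση x₁ w u η) (hσw : 0 < σw) (s : LinSys dx du dy) (k : ℕ)
    {v : EuclideanSpace ℝ (Fin dx)} (hv : ‖v‖ ≤ 1) {c : ℝ} (hc : 0 < c)
    (hcv : c ^ 2 / 2 ≤ ‖Matrix.toEuclideanLin (s.C * s.A ^ k) v‖ ^ 2) (ρ : ℝ) :
    μ {ω | ‖s.output x₁ w u η (k + 1) ω‖ ^ 2 < ρ}
      ≤ ENNReal.ofReal (2 * √ρ / (σw * c)) := by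
  set H := s.C * s.A ^ k with hH
  set f := Matrix.toEuclideanLin H v with hf
  have hf2 : 0 < ‖f‖ ^ 2 := lt_of_lt_of_le (by positivity) hcv
  have hf0 : 0 < ‖f‖ := by
    by_contra hcon
    have : ‖f‖ = 0 := le_antisymm (not_lt.1 hcon) (norm_nonneg _)
    rw [this] at hf2
    norm_num at hf2
  -- Projecting on the direction of `H v` makes the problem scalar; the noise then enters through `a
  -- = Hᵀ e`, whose norm is at least `‖H v‖`.
  set e : EuclideanSpace ℝ (Fin dy) := ‖f‖⁻¹ • f with he
  have hen : ‖e‖ = 1 := by rw [he, norm_smul, norm_inv, norm_norm, inv_mul_cancel₀ hf0.ne']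
  set a : EuclideanSpace ℝ (Fin dx) := Matrix.toEuclideanLin Hᵀ e with ha
  have hadj : ∀ x, inner ℝ e (Matrix.toEuclideanLin H x) = inner ℝ a x := by
    intro x
    rw [ha]
    simp only [EuclideanSpace.inner_eq_star_dotProduct, Matrix.toLpLin_apply, star_trivial]
    rw [Matrix.mulVec_transpose, dotProduct_comm, Matrix.dotProduct_mulVec, dotProduct_comm]
  have hna : ‖f‖ ≤ ‖a‖ := by
    have h1 : inner ℝ a v = ‖f‖ := by
      rw [← hadj, ← hf, he, real_inner_smul_left, real_inner_self_eq_norm_sq, sq, ← mul_assoc,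
        inv_mul_cancel₀ hf0.ne', one_mul]
    calc ‖f‖ = inner ℝ a v := h1.symm
      _ ≤ ‖a‖ * ‖v‖ := real_inner_le_norm _ _
      _ ≤ ‖a‖ * 1 := mul_le_mul_of_nonneg_left hv (norm_nonneg _)
      _ = ‖a‖ := mul_one _
  let R : Ω → ℝ := fun ω => inner ℝ e (s.output x₁ (Function.update w 0 0) u η (k + 1) ω)
  have hdecomp : ∀ ω, inner ℝ e (s.output x₁ w u η (k + 1) ω) = inner ℝ a (w 0 ω) + R ω := by
    intro ω
    simp only [R, LinSys.output]
    rw [LinSys.state_succ_eq_add_first, map_add, ← LinSys.toEuclideanLin_mul_apply, ← hH, ← hadj,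
      ← inner_add_right]
    congr 1
    abel
  have hRind : Measurable[⨆ j ∈ ({Sum.inr (Sum.inl 0)}ᶜ : Set _), modelSigma x₁ w u η j] R := by
    have h1 := @LinSys.measurable_output dx du dy Ω s x₁ (Function.update w 0 0) u η
      (⨆ j ∈ ({Sum.inr (Sum.inl 0)}ᶜ : Set _), modelSigma x₁ w u η j)
      (measurable_iSup_modelSigma (Sum.inl ()) (by simp) (comap_measurable _))
      (fun j => by
        rcases Nat.eq_zero_or_pos j with rfl | hj
        · rw [Function.update_self]; exact measurable_const
        · rw [Function.update_of_ne hj.ne']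
          exact measurable_iSup_modelSigma (Sum.inr (Sum.inl j)) (by simpa using hj.ne')
            (comap_measurable _))
      (fun j => measurable_iSup_modelSigma (Sum.inr (Sum.inr (Sum.inl j))) (by simp)
        (comap_measurable _))
      (fun j => measurable_iSup_modelSigma (Sum.inr (Sum.inr (Sum.inr j))) (by simp)
        (comap_measurable _)) (k + 1)
    have h2 : Measurable fun y : EuclideanSpace ℝ (Fin dy) => inner ℝ e y := by fun_prop
    exact h2.comp h1
  have hRm : Measurable R := hRind.mono (iSup₂_le fun i _ => h.modelSigma_le i) le_rfl
  have hind : IndepFun (fun ω => inner ℝ a (w 0 ω)) R μ := by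
    refine h.indepFun_of_measurable (Sum.inr (Sum.inl 0)) ?_ hRind
    have h2 : Measurable fun y : EuclideanSpace ℝ (Fin dx) => inner ℝ a y := by fun_prop
    exact h2.comp (comap_measurable (w 0))
  have ha0 : 0 < ‖a‖ := hf0.trans_le hna
  have hvar : (σw ^ 2 * ‖a‖ ^ 2).toNNReal ≠ 0 := by
    rw [Ne, Real.toNNReal_eq_zero, not_le]
    positivity
  have hanti := measure_abs_add_lt_le_of_indepFun hvar (hasLaw_inner_of_isotropic (h.law_w 0) a)
    hRm hind (√ρ)
  rw [Real.coe_toNNReal _ (by positivity)] at hanti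
  refine (measure_mono ?_).trans (hanti.trans (ENNReal.ofReal_le_ofReal ?_))
  · intro ω hω
    simp only [Set.mem_ofPred_eq] at hω ⊢
    rw [← hdecomp]
    apply Real.lt_sqrt_of_sq_lt
    refine lt_of_le_of_lt ?_ hω
    have := abs_real_inner_le_norm e (s.output x₁ w u η (k + 1) ω)
    rw [hen, one_mul] at this
    exact pow_le_pow_left₀ (abs_nonneg _) this 2
  · refine div_le_div_of_nonneg_left (by positivity) (by positivity) ?_
    apply Real.le_sqrt_of_sq_le
    have h1 : c ^ 2 / 2 ≤ ‖a‖ ^ 2 := hcv.trans (pow_le_pow_left₀ hf0.le hna 2)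
    -- In `2π‖a‖² ≥ π c² ≥ c²` the constant of the Gaussian density absorbs the `1/2` in the gain.
    have h2 : 1 ≤ Real.pi := by linarith [Real.pi_gt_three]
    have h3 : c ^ 2 ≤ Real.pi * (2 * ‖a‖ ^ 2) := by nlinarith [sq_nonneg ‖a‖]
    calc (σw * c) ^ 2 = σw ^ 2 * c ^ 2 := by ring
      _ ≤ σw ^ 2 * (Real.pi * (2 * ‖a‖ ^ 2)) := mul_le_mul_of_nonneg_left h3 (sq_nonneg _)
      _ = 2 * Real.pi * (σw ^ 2 * ‖a‖ ^ 2) := by ring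

end Model

/-! ### Unstable case: the growing direction, the size of the threshold, the horizon -/

theorem sq_norm_toEuclideanLin_ofReal {m n : ℕ} (H : Matrix (Fin m) (Fin n) ℝ)
    (q : EuclideanSpace ℂ (Fin n)) :
    ‖Matrix.toEuclideanLin (H.map (fun r : ℝ => (r : ℂ))) q‖ ^ 2
      = ‖Matrix.toEuclideanLin H (WithLp.toLp 2 fun i => (q i).re)‖ ^ 2
        + ‖Matrix.toEuclideanLin H (WithLp.toLp 2 fun i => (q i).im)‖ ^ 2 := by
  rw [EuclideanSpace.norm_sq_eq, EuclideanSpace.real_norm_sq_eq, EuclideanSpace.real_norm_sq_eq,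
    ← Finset.sum_add_distrib]
  refine Finset.sum_congr rfl fun i _ => ?_
  rw [← Complex.normSq_eq_norm_sq, Complex.normSq_apply]
  simp [Matrix.toLpLin_apply, Matrix.mulVec, dotProduct, sq]

/-- On the unstable eigenvector `q` the gain of `C Aᵏ` is at least `(1 + εa)ᵏ εc`. A real matrix
acts separately on real and imaginary parts, so one of them carries half of the squared gain, and
its norm is at most `‖q‖`. -/
theorem LinSys.exists_real_direction {dx du dy : ℕ} {s : LinSys dx du dy} {εa εc : ℝ}
    (hεa : 0 < εa) (hεc : 0 < εc) (hrad : ENNReal.ofReal (1 + εa) ≤ s.specRad)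
    (hobs : s.StrictlyObservable εc) (k : ℕ) :
    ∃ v : EuclideanSpace ℝ (Fin dx), ‖v‖ ≤ 1 ∧
      ((1 + εa) ^ k * εc) ^ 2 / 2 ≤ ‖Matrix.toEuclideanLin (s.C * s.A ^ k) v‖ ^ 2 := by
  set Ac := s.A.map (fun r : ℝ => (r : ℂ)) with hAc
  have hz : ∃ z ∈ spectrum ℂ Ac, 1 + εa ≤ ‖z‖ := by
    by_contra hcon
    push Not at hcon
    refine absurd hrad (not_le.2 ?_)
    -- For `dx = 0` the spectrum is empty and the spectral radius is `0`.
    rcases isEmpty_or_nonempty (Fin dx) with hd | hd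
    · have : spectralRadius ℂ Ac = 0 := by
        have : Subsingleton (Matrix (Fin dx) (Fin dx) ℂ) := inferInstance
        exact spectrum.SpectralRadius.of_subsingleton _
      rw [LinSys.specRad, ← hAc, this]
      exact ENNReal.ofReal_pos.2 (by linarith)
    · refine spectrum.spectralRadius_lt_of_forall_lt Ac (r := (1 + εa).toNNReal) fun z hz => ?_
      rw [← NNReal.coe_lt_coe, Real.coe_toNNReal _ (by linarith)]
      exact hcon z hz
  obtain ⟨z, hzs, hz1⟩ := hz
  rw [← Matrix.spectrum_toLpLin 2, ← Module.End.hasEigenvalue_iff_mem_spectrum] at hzs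
  obtain ⟨q, hq⟩ := hzs.exists_hasEigenvector
  have hq0 : q ≠ 0 := hq.2
  have hqz : Matrix.toEuclideanLin Ac q = z • q := hq.apply_eq_smul
  have hpow : ∀ j, Matrix.toEuclideanLin (Ac ^ j) q = z ^ j • q := by
    intro j
    induction j with
    | zero => simp
    | succ j ih =>
      have : Matrix.toEuclideanLin (Ac ^ (j + 1)) q
          = Matrix.toEuclideanLin (Ac ^ j) (Matrix.toEuclideanLin Ac q) := by
        simp [Matrix.toLpLin_apply, pow_succ]
      rw [this, hqz, map_smul, ih, smul_smul, pow_succ, mul_comm]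
  have hmap : (s.C * s.A ^ k).map (fun r : ℝ => (r : ℂ))
      = s.C.map (fun r : ℝ => (r : ℂ)) * Ac ^ k := by
    have h1 := Matrix.map_mul (L := s.C) (M := s.A ^ k) (f := Complex.ofRealHom)
    have h2 := Matrix.map_pow s.A Complex.ofRealHom k
    rw [h2] at h1
    exact h1
  have hlow : (1 + εa) ^ k * εc * ‖q‖
      ≤ ‖Matrix.toEuclideanLin ((s.C * s.A ^ k).map (fun r : ℝ => (r : ℂ))) q‖ := by
    have : Matrix.toEuclideanLin (s.C.map (fun r : ℝ => (r : ℂ)) * Ac ^ k) q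
        = Matrix.toEuclideanLin (s.C.map (fun r : ℝ => (r : ℂ)))
          (Matrix.toEuclideanLin (Ac ^ k) q) := by
      simp [Matrix.toLpLin_apply]
    rw [hmap, this, hpow, map_smul, norm_smul, norm_pow, mul_assoc]
    have h0 : 0 ≤ 1 + εa := by linarith
    exact mul_le_mul (pow_le_pow_left₀ h0 hz1 k) (hobs z q hq0 hqz) (by positivity) (by positivity)
  have hqn : 0 < ‖q‖ := norm_pos_iff.2 hq0
  have hsq := pow_le_pow_left₀ (by positivity) hlow 2
  rw [sq_norm_toEuclideanLin_ofReal, mul_pow] at hsq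
  have hnorm := sq_norm_toEuclideanLin_ofReal (1 : Matrix (Fin dx) (Fin dx) ℝ) q
  have hone : (1 : Matrix (Fin dx) (Fin dx) ℝ).map (fun r : ℝ => (r : ℂ)) = 1 :=
    Matrix.map_one _ Complex.ofReal_zero Complex.ofReal_one
  rw [hone, LinSys.toEuclideanLin_one_apply, LinSys.toEuclideanLin_one_apply] at hnorm
  have hid : Matrix.toEuclideanLin (1 : Matrix (Fin dx) (Fin dx) ℂ) q = q := by simp
  rw [hid] at hnorm
  have key : ∀ x : EuclideanSpace ℝ (Fin dx), ‖x‖ ^ 2 ≤ ‖q‖ ^ 2 →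
      ((1 + εa) ^ k * εc) ^ 2 * ‖q‖ ^ 2 / 2 ≤ ‖Matrix.toEuclideanLin (s.C * s.A ^ k) x‖ ^ 2 →
      ∃ v : EuclideanSpace ℝ (Fin dx), ‖v‖ ≤ 1 ∧
      ((1 + εa) ^ k * εc) ^ 2 / 2 ≤ ‖Matrix.toEuclideanLin (s.C * s.A ^ k) v‖ ^ 2 := by
    intro x hx hxl
    refine ⟨‖q‖⁻¹ • x, ?_, ?_⟩
    · rw [norm_smul, norm_inv, norm_norm, inv_mul_le_one₀ hqn]
      exact le_of_sq_le_sq hx hqn.le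
    · rw [map_smul, norm_smul, norm_inv, norm_norm, mul_pow ‖q‖⁻¹, inv_pow, ← div_eq_inv_mul,
        le_div_iff₀ (by positivity)]
      linarith
  rcases le_total (‖Matrix.toEuclideanLin (s.C * s.A ^ k) (WithLp.toLp 2 fun i => (q i).re)‖ ^ 2)
    (‖Matrix.toEuclideanLin (s.C * s.A ^ k) (WithLp.toLp 2 fun i => (q i).im)‖ ^ 2) with hle | hle
  · refine key (WithLp.toLp 2 fun i => (q i).im) ?_ (by linarith)
    rw [hnorm]
    exact le_add_of_nonneg_left (sq_nonneg _)
  · refine key (WithLp.toLp 2 fun i => (q i).re) ?_ (by linarith)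
    rw [hnorm]
    exact le_add_of_nonneg_right (sq_nonneg _)

theorem trace_le_mul_norm {n : ℕ} (P : Matrix (Fin n) (Fin n) ℝ) : P.trace ≤ n * ‖P‖ := by
  have hentry : ∀ i, P i i ≤ ‖P‖ := by
    intro i
    have h1 := Matrix.l2_opNorm_mulVec P (EuclideanSpace.single i (1 : ℝ))
    rw [PiLp.norm_single, norm_one, mul_one] at h1
    have h2 := PiLp.norm_apply_le ((EuclideanSpace.equiv (Fin n) ℝ).symm
      (P.mulVec (EuclideanSpace.single i (1 : ℝ)).ofLp)) i
    have h3 : ((EuclideanSpace.equiv (Fin n) ℝ).symm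
      (P.mulVec (EuclideanSpace.single i (1 : ℝ)).ofLp)) i = P i i := by simp
    rw [h3] at h2
    exact (le_abs_self _).trans (h2.trans h1)
  calc P.trace = ∑ i, P i i := rfl
    _ ≤ ∑ _i : Fin n, ‖P‖ := Finset.sum_le_sum fun i _ => hentry i
    _ = n * ‖P‖ := by simp

theorem trace_conj_le {m n : ℕ} (B : Matrix (Fin n) (Fin m) ℝ) (P : Matrix (Fin n) (Fin n) ℝ) :
    (Bᵀ * P * B).trace ≤ m * (‖B‖ ^ 2 * ‖P‖) := by
  refine (trace_le_mul_norm _).trans (mul_le_mul_of_nonneg_left ?_ (Nat.cast_nonneg m))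
  have hB : ‖Bᵀ‖ = ‖B‖ := by
    rw [← Matrix.conjTranspose_eq_transpose_of_trivial, Matrix.l2_opNorm_conjTranspose]
  calc ‖Bᵀ * P * B‖ ≤ ‖Bᵀ * P‖ * ‖B‖ := Matrix.l2_opNorm_mul _ _
    _ ≤ ‖Bᵀ‖ * ‖P‖ * ‖B‖ :=
        mul_le_mul_of_nonneg_right (Matrix.l2_opNorm_mul _ _) (norm_nonneg _)
    _ = ‖B‖ ^ 2 * ‖P‖ := by rw [hB]; ring

/-- Traces are at most dimension times operator norm, so the dimensions enter only through the
factor `2 + dx + du + dy`, and neither the family nor its size matters. -/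
theorem threshold_le {dx du dy : ℕ} {S : Set (LinSys dx du dy)} {σw σu ση p b M δ : ℝ}
    (hM : 0 ≤ M) (hδ : 0 ≤ Real.log (1 / δ))
    (hS : ∀ s ∈ S, s.Stable → ‖s.B‖ ≤ b ∧ ∀ P, s.IsLyapunovSolution P → ‖P‖ ≤ p) (τ : ℕ) :
    threshold S σw σu ση M τ δ ≤ 2 * M + 10 * τ *
      ((σw ^ 2 * |p| + σu ^ 2 * (b ^ 2 * |p|) + ση ^ 2) * (2 + dx + du + dy))
        * Real.log (1 / δ) := by
  -- The bound must be nonnegative because the supremum is `0` without stable members; hence `|p|`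
  -- in place of `p`.
  refine Real.sSup_le ?_ (by positivity)
  rintro r ⟨s, hs, hst, P, hP, rfl⟩
  obtain ⟨hB, hPp⟩ := hS s hs hst
  have hPp' : ‖P‖ ≤ |p| := (hPp P hP).trans (le_abs_self p)
  have hB' : ‖s.B‖ ^ 2 ≤ b ^ 2 := pow_le_pow_left₀ (norm_nonneg _) hB 2
  have h1 : P.trace ≤ (2 + dx + du + dy) * |p| := by
    refine (trace_le_mul_norm P).trans (mul_le_mul ?_ hPp' (norm_nonneg _) (by positivity))
    have : (0 : ℝ) ≤ du := Nat.cast_nonneg _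
    have : (0 : ℝ) ≤ dy := Nat.cast_nonneg _
    linarith
  have h2 : (s.Bᵀ * P * s.B).trace ≤ (2 + dx + du + dy) * (b ^ 2 * |p|) := by
    refine (trace_conj_le s.B P).trans (mul_le_mul ?_
      (mul_le_mul hB' hPp' (norm_nonneg _) (sq_nonneg _)) (by positivity) (by positivity))
    have : (0 : ℝ) ≤ dx := Nat.cast_nonneg _
    have : (0 : ℝ) ≤ dy := Nat.cast_nonneg _
    linarith
  have h3 : ((max dx dy : ℕ) : ℝ) ≤ 2 + dx + du + dy := by
    have : max dx dy ≤ 2 + dx + du + dy := by omega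
    exact_mod_cast this
  have h4 : σw ^ 2 * P.trace + σu ^ 2 * (s.Bᵀ * P * s.B).trace + ση ^ 2 * (max dx dy : ℕ)
      ≤ (σw ^ 2 * |p| + σu ^ 2 * (b ^ 2 * |p|) + ση ^ 2) * (2 + dx + du + dy) := by
    have := mul_le_mul_of_nonneg_left h1 (sq_nonneg σw)
    have := mul_le_mul_of_nonneg_left h2 (sq_nonneg σu)
    have := mul_le_mul_of_nonneg_left h3 (sq_nonneg ση)
    linarith
  gcongr

/-- The choice of the horizon: exponential growth at rate `q` beats a threshold that is linear in
the horizon. -/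
theorem exists_horizon {q κ c₁ : ℝ} (hq : 1 < q) (hκ : 0 < κ) (hc₁ : 0 ≤ c₁) :
    ∃ K : ℝ, 0 < K ∧ ∀ D M δ : ℝ, 2 ≤ D → 0 ≤ M → 0 < δ → δ < Real.exp (-1) →
      ∃ k : ℕ, ((k : ℝ) + 2) ≤ K * Real.log D * Real.log ((Real.log (1 / δ) + M) / δ) ∧
        8 * (2 * M + 10 * ((k : ℝ) + 2) * (c₁ * D) * Real.log (1 / δ))
          ≤ δ ^ 2 * (κ * (q ^ k) ^ 2) := by
  set α := Real.log q with hα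
  have hα0 : 0 < α := Real.log_pos hq
  -- `16` and `80` are `8 · 2` and `8 · 10`; `c₃` collects the constants so that `c₃ D X² ≤ qᵏ`
  -- suffices below.
  set c₂ : ℝ := 16 + 80 * c₁ with hc₂
  have hc₂0 : 0 < c₂ := by positivity
  set c₃ : ℝ := c₂ * Real.exp (2 * α) / (κ * α) with hc₃
  have hc₃0 : 0 < c₃ := by positivity
  refine ⟨(2 * |Real.log c₃| + 5) / α + 6, by positivity, ?_⟩
  intro D M δ hD hM hδ hδ1
  set L := Real.log (1 / δ) with hL
  have hLδ : Real.exp (-L) = δ := by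
    rw [hL, one_div, Real.log_inv, neg_neg, Real.exp_log hδ]
  have hL1 : 1 ≤ L := by
    rw [← hLδ, Real.exp_lt_exp] at hδ1
    linarith
  set X := (L + M) / δ with hX
  have hLM : 1 ≤ L + M := by linarith
  have hX0 : 0 < X := by positivity
  set R := Real.log X with hR
  have hR1 : 1 ≤ R := by
    refine hL1.trans (Real.log_le_log (by positivity) ?_)
    exact div_le_div_of_nonneg_right hLM hδ.le
  have hlD : 1 / 2 ≤ Real.log D := by
    have h1 := Real.log_two_gt_d9
    have h2 := Real.log_le_log two_pos hD
    linarith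
  -- One factor `qᵏ` has to beat `c₃ D X²`, whose logarithm is the numerator up to the absolute
  -- value. The other factor `qᵏ` absorbs the linear term `k + 2`.
  set k := ⌈(|Real.log c₃| + Real.log D + 2 * R) / α⌉₊ with hk
  have hkα : |Real.log c₃| + Real.log D + 2 * R ≤ α * k := by
    have := Nat.le_ceil ((|Real.log c₃| + Real.log D + 2 * R) / α)
    rw [div_le_iff₀ hα0] at this
    linarith
  refine ⟨k, ?_, ?_⟩
  · have h1 := Nat.ceil_lt_add_one
      (show 0 ≤ (|Real.log c₃| + Real.log D + 2 * R) / α by positivity)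
    -- Since `log D ≥ 1/2` and `R ≥ 1`, each summand is at most a multiple of the product `log D *
    -- R`; this gives the `5` and the `6` in `K`.
    have hDR : 1 / 2 ≤ Real.log D * R := by nlinarith
    have h2 : |Real.log c₃| + Real.log D + 2 * R
        ≤ (2 * |Real.log c₃| + 5) * (Real.log D * R) := by
      have e1 : |Real.log c₃| ≤ 2 * |Real.log c₃| * (Real.log D * R) := by
        nlinarith [abs_nonneg (Real.log c₃)]
      have e2 : Real.log D ≤ Real.log D * R := by nlinarith
      have e3 : 2 * R ≤ 4 * (Real.log D * R) := by nlinarith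
      linarith
    have h3 := div_le_div_of_nonneg_right h2 hα0.le
    calc (k : ℝ) + 2 ≤ (2 * |Real.log c₃| + 5) * (Real.log D * R) / α + 6 * (Real.log D * R) := by
          linarith
      _ = ((2 * |Real.log c₃| + 5) / α + 6) * Real.log D * R := by ring
  · have hqk : q ^ k = Real.exp (α * k) := by
      rw [hα, mul_comm, Real.exp_nat_mul, Real.exp_log (by linarith)]
    have hDpos : 0 < D := by linarith
    have hgrow : c₃ * D * X ^ 2 ≤ Real.exp (α * k) := by
      have e1 : c₃ * D * X ^ 2 = Real.exp (Real.log c₃ + Real.log D + 2 * R) := by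
        rw [Real.exp_add, Real.exp_add, Real.exp_log hc₃0, Real.exp_log hDpos, two_mul,
          Real.exp_add, hR, Real.exp_log hX0, sq]
      rw [e1]
      exact Real.exp_le_exp.2 (by linarith [le_abs_self (Real.log c₃)])
    have hlin : α * ((k : ℝ) + 2) ≤ Real.exp (2 * α) * Real.exp (α * k) := by
      rw [← Real.exp_add]
      have := Real.add_one_le_exp (2 * α + α * k)
      linarith
    -- The right side is `(L + M)²` and `L + M ≥ 1`. This produces the `δ²` that the small-ball
    -- bound demands.
    have hLM2 : L + M ≤ δ ^ 2 * X ^ 2 := by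
      rw [hX, div_pow, mul_div_cancel₀ _ (by positivity)]
      nlinarith
    have hk2 : (0 : ℝ) ≤ (k : ℝ) + 2 := by positivity
    have hone : 1 ≤ ((k : ℝ) + 2) * D := by nlinarith [Nat.cast_nonneg (α := ℝ) k]
    have hstep1 : 8 * (2 * M + 10 * ((k : ℝ) + 2) * (c₁ * D) * L)
        ≤ c₂ * (((k : ℝ) + 2) * D) * (L + M) := by
      have e1 : 16 * M ≤ 16 * (((k : ℝ) + 2) * D) * (L + M) := by nlinarith
      have e2 : 80 * c₁ * (((k : ℝ) + 2) * D) * L ≤ 80 * c₁ * (((k : ℝ) + 2) * D) * (L + M) :=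
        mul_le_mul_of_nonneg_left (by linarith) (by positivity)
      rw [hc₂]
      linarith
    have hαne : α ≠ 0 := hα0.ne'
    calc 8 * (2 * M + 10 * ((k : ℝ) + 2) * (c₁ * D) * L)
        ≤ c₂ * (((k : ℝ) + 2) * D) * (L + M) := hstep1
      _ = c₂ / α * D * (α * ((k : ℝ) + 2)) * (L + M) := by field_simp
      _ ≤ c₂ / α * D * (Real.exp (2 * α) * Real.exp (α * k)) * (δ ^ 2 * X ^ 2) := by gcongr
      _ = δ ^ 2 * κ * Real.exp (α * k) * (c₃ * D * X ^ 2) := by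
          rw [hc₃]; field_simp
      _ ≤ δ ^ 2 * κ * Real.exp (α * k) * Real.exp (α * k) := by gcongr
      _ = δ ^ 2 * (κ * (q ^ k) ^ 2) := by rw [hqk]; ring

/-! ### Assembly of the two cases -/

theorem mainTheorem2 (εa εc σw σu ση p b : ℝ) (hεa : 0 < εa) (hεc : 0 < εc)
    (hσw : 0 < σw) (hσu : 0 ≤ σu) (hση : 0 ≤ ση) :
    ∃ K : ℝ, 0 < K ∧
      ∀ (dx du dy : ℕ) (S : Set (LinSys dx du dy)), S.Finite → ∀ s' ∈ S,
      ∀ (Ω : Type*) [MeasurableSpace Ω] (μ : Measure Ω) [IsProbabilityMeasure μ]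
        (x₁ : Ω → EuclideanSpace ℝ (Fin dx)) (w : ℕ → Ω → EuclideanSpace ℝ (Fin dx))
        (u : ℕ → Ω → EuclideanSpace ℝ (Fin du)) (η : ℕ → Ω → EuclideanSpace ℝ (Fin dy)),
      IsNoiseModel μ σw σu ση x₁ w u η →
      ∀ (M δ : ℝ), 0 ≤ M → 0 < δ → δ < Real.exp (-1) →
        -- stable case: conditionally on the transient being bounded by `M`,
        -- the outputs stay below the threshold for all times simultaneously
        (s'.Stable →
          (1 - δ) * μ.real {ω | TransientBound S M (x₁ ω)} ≤
            μ.real {ω | TransientBound S M (x₁ ω) ∧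
              ∀ τ : ℕ, 0 < τ →
                s'.outputEnergy x₁ w u η τ ω ≤ threshold S σw σu ση M τ δ}) ∧
        -- unstable case
        (¬ s'.Stable → ENNReal.ofReal (1 + εa) ≤ s'.specRad → s'.StrictlyObservable εc →
          (∀ s ∈ S, s.Stable → ‖s.B‖ ≤ b ∧ ∀ P, s.IsLyapunovSolution P → ‖P‖ ≤ p) →
          ∃ τ : ℕ, 0 < τ ∧
            (τ : ℝ) ≤ K * Real.log (2 + dx + du + dy) *
              Real.log ((Real.log (1 / δ) + M) / δ) ∧
            1 - δ ≤ μ.real {ω |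
              2 * threshold S σw σu ση M τ δ ≤ s'.outputEnergy x₁ w u η τ ω}) := by
  obtain ⟨K, hK, hKτ⟩ := exists_horizon (q := 1 + εa) (κ := (σw * εc) ^ 2)
    (c₁ := σw ^ 2 * |p| + σu ^ 2 * (b ^ 2 * |p|) + ση ^ 2) (by linarith) (by positivity)
    (by positivity)
  refine ⟨K, hK, ?_⟩
  intro dx du dy S hS s hsS Ω _ μ _ x₁ w u η h M δ hM hδ hδ1
  refine ⟨fun hs => h.stable_energy_bound hS hsS hs M hδ hδ1, ?_⟩
  intro _ hrad hobs hbd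
  obtain ⟨k, hk1, hk2⟩ := hKτ (2 + dx + du + dy) M δ
    (by linarith [Nat.cast_nonneg (α := ℝ) dx, Nat.cast_nonneg (α := ℝ) du,
      Nat.cast_nonneg (α := ℝ) dy]) hM hδ hδ1
  have hlog : 0 ≤ Real.log (1 / δ) := by
    refine Real.log_nonneg (one_le_one_div hδ (hδ1.le.trans ?_))
    exact Real.exp_le_one_iff.2 (by norm_num)
  -- The noise with index `0` reaches the output with index `k + 1` through `C Aᵏ`, and that output
  -- is the last of the first `k + 2`.
  refine ⟨k + 2, by omega, by push_cast; exact hk1, ?_⟩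
  obtain ⟨v, hv, hcv⟩ := LinSys.exists_real_direction hεa hεc hrad hobs k
  set ξ := threshold S σw σu ση M (k + 2) δ with hξ
  have hξle := threshold_le (σw := σw) (σu := σu) (ση := ση) hM hlog hbd (k + 2)
  push_cast at hξle
  rw [← hξ] at hξle
  set c := (1 + εa) ^ k * εc with hc
  have hc0 : 0 < c := by positivity
  have hprob := h.measure_sq_norm_output_lt_le hσw s k hv hc0 hcv (2 * ξ)
  have hδle : 2 * √(2 * ξ) / (σw * c) ≤ δ := by
    rw [div_le_iff₀ (by positivity)]
    -- Squaring `2 √(2 ξ) ≤ δ σw c` gives the factor `8`.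
    have h8 : 8 * ξ ≤ (δ * (σw * c)) ^ 2 := by
      calc 8 * ξ ≤ _ := mul_le_mul_of_nonneg_left hξle (by norm_num)
        _ ≤ _ := hk2
        _ = (δ * (σw * c)) ^ 2 := by rw [hc]; ring
    have h2 : √(2 * ξ) ≤ δ * (σw * c) / 2 := by
      refine Real.sqrt_le_iff.2 ⟨by positivity, ?_⟩
      rw [div_pow]
      linarith
    linarith
  set G : Set Ω := {ω | 2 * ξ ≤ s.outputEnergy x₁ w u η (k + 2) ω} with hG
  have hsub : Gᶜ ⊆ {ω | ‖s.output x₁ w u η (k + 1) ω‖ ^ 2 < 2 * ξ} := by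
    intro ω hω
    have hω' : s.outputEnergy x₁ w u η (k + 2) ω < 2 * ξ := not_le.1 hω
    refine lt_of_le_of_lt ?_ hω'
    exact Finset.single_le_sum (f := fun t => ‖s.output x₁ w u η t ω‖ ^ 2)
      (fun t _ => by positivity) (Finset.mem_range.2 (by omega))
  have hGc : μ.real Gᶜ ≤ δ := by
    refine ENNReal.toReal_le_of_le_ofReal hδ.le ?_
    exact (measure_mono hsub).trans (hprob.trans (ENNReal.ofReal_le_ofReal hδle))
  have hunion := measureReal_union_le (μ := μ) G Gᶜ
  rw [Set.union_compl_self, probReal_univ] at hunion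
  linarith
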